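/- Theorem 1.6. Let $\mathcal S_n$ be the set of permutations of size $n$. For a set $I$ of positions of a permutation $\sigma$, let $\mathrm{pat}_I(\sigma)$ be the permutation of size $|I|$ whose values are in the same relative order as $(\sigma(i))_{i\in I}$. Let $\mathrm{Av}_n(312)$ be the set of $\sigma\in\mathcal S_n$ such that $\mathrm{pat}_I(\sigma)\neq 312$ for all $I$, and let $\mathrm{Av}(312)=\bigcup_{n\ge 1}\mathrm{Av}_n(312)$. For $\pi\in\mathcal S_k$ and $\sigma\in\mathcal S_n$ with $n\ge1$, let $\widetilde{\mathrm{c\text{-}occ}}(\pi,\sigma)$ be the number of intervals $I\subseteq\{1,\dots,n\}$ with $\mathrm{pat}_I(\sigma)=\pi$, divided by $n$. For $k\ge 1$, the feasible region $P_k^{\mathrm{Av}(312)}$ is the set of vectors $\vec v\in[0,1]^{\mathcal S_k}$ for which there is a sequence $(\sigma^m)_{m\ge1}$ in $\mathrm{Av}(312)$ with $|\sigma^m|\to\infty$ and $\widetilde{\mathrm{c\text{-}occ}}(\pi,\sigma^m)\to\vec v_\pi$ for all $\pi\in\mathcal S_k$. The overlap graph $\mathcal{O}v(k,\mathrm{Av}(312))$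 is the directed multigraph with vertex set $\mathrm{Av}_{k-1}(312)$ that has, for every $\pi\in \mathrm{Av}_k(312)$, one edge labelled by $\pi$, which goes from the pattern induced by the first $k-1$ positions of $\pi$ to the pattern induced by the last $k-1$ positions of $\pi$ (for $k=1$ the only vertex is the empty permutation). A simple cycle of a directed multigraph $G$ is a non-empty closed walk $\mathcal C=(e_1,\dots,e_r)$ with distinct edges that visits no vertex twice, except that its first and last vertices coincide. Its vector $\vec e_{\mathcal C}\in\mathbb R^{E(G)}$ has coordinate $1/r$ at each of the edges $e_1,\dots,e_r$ and $0$ at all other edges. The cycle polytope of $G$ is the convex hull of the vectors $\vec e_{\mathcal C}$ of all simple cycles $\mathcal C$ of $G$. Vectors in $\mathbb R^{\mathrm{Av}_k(312)}$ are viewed in $\mathbb R^{\mathcal S_k}$ by setting the missing coordinates to $0$. Then, for every integer $k\ge1$, the following hold. 1. $P_k^{\mathrm{Av}(312)}$ equals the cycle polytope of $\mathcal{O}v(k,\mathrm{Av}(312))$. 2. The dimension of $P_k^{\mathrm{Av}(312)}$ (that is, of its affine hull) is $C_k-C_{k-1}$, where $C_j=\frac1{j+1}\binom{2j}{j}$ is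 the $j$-th Catalan number. 3. The vertices (extreme points) of $P_k^{\mathrm{Av}(312)}$ are exactly the vectors $\vec e_{\mathcal C}$, where $\mathcal C$ runs over the simple cycles of $\mathcal{O}v(k,\mathrm{Av}(312))$. -/

import Mathlib

open Filter Topology

namespace ConsecutivePatterns

/-- Standardization: for an injective sequence `x` of `m` elements of a linear order, the unique
permutation of size `m` whose values are in the same relative order (see `std_lt_std_iff` and
`std_eq_of_lt_iff`). Permutations of size `m` are permutations of `Fin m`, i.e. positions and
values are numbered from `0`. -/
def std {m : ℕ} {α : Type*} [LinearOrder α] (x : Fin m → α) : Equiv.Perm (Fin m) :=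
  (Tuple.sort x).symm

theorem std_lt_std_iff {m : ℕ} {α : Type*} [LinearOrder α] {x : Fin m → α}
    (hx : Function.Injective x) (i j : Fin m) : std x i < std x j ↔ x i < x j := by
  have hmono : StrictMono (x ∘ Tuple.sort x) :=
    (Tuple.monotone_sort x).strictMono_of_injective (hx.comp (Tuple.sort x).injective)
  have h := hmono.lt_iff_lt (a := std x i) (b := std x j)
  simpa [std] using h.symm

theorem eq_of_lt_iff_lt {m : ℕ} {π ρ : Equiv.Perm (Fin m)}
    (h : ∀ i j, π i < π j ↔ ρ i < ρ j) : π = ρ := by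
  have hmono : StrictMono (fun i => π (ρ.symm i)) := by
    intro a b hab
    exact (h _ _).2 (by simpa using hab)
  have hid := Subsingleton.elim
    (hmono.orderIsoOfSurjective _ (π.surjective.comp ρ.symm.surjective)) (OrderIso.refl (Fin m))
  ext i
  have hi := congrArg (fun e : Fin m ≃o Fin m => e (ρ i)) hid
  simp at hi
  exact congrArg Fin.val hi

theorem std_eq_of_lt_iff {m : ℕ} {α : Type*} [LinearOrder α] {x : Fin m → α}
    (hx : Function.Injective x) {π : Equiv.Perm (Fin m)}
    (h : ∀ i j, π i < π j ↔ x i < x j) : std x = π :=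
  eq_of_lt_iff_lt fun i j => (std_lt_std_iff hx i j).trans (h i j).symm

/-- The pattern `pat_I(σ)` induced by a set `I` of `m` positions of `σ`. The set `I` is given by its
increasing enumeration `f : Fin m ↪o Fin n`. -/
def pat {m n : ℕ} (f : Fin m ↪o Fin n) (σ : Equiv.Perm (Fin n)) : Equiv.Perm (Fin m) :=
  std (fun i => σ (f i))

theorem pat_lt_pat_iff {m n : ℕ} (f : Fin m ↪o Fin n) (σ : Equiv.Perm (Fin n)) (i j : Fin m) :
    pat f σ i < pat f σ j ↔ σ (f i) < σ (f j) :=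
  std_lt_std_iff (σ.injective.comp f.injective) i j

theorem pat_pat {l m n : ℕ} (f : Fin l ↪o Fin m) (g : Fin m ↪o Fin n) (σ : Equiv.Perm (Fin n)) :
    pat f (pat g σ) = pat (f.trans g) σ :=
  eq_of_lt_iff_lt fun i j => by simp [pat_lt_pat_iff]

/-- The interval of positions `s, s + 1, …, s + m - 1`. -/
def intervalEmb {m n : ℕ} (s : ℕ) (h : s + m ≤ n) : Fin m ↪o Fin n :=
  OrderEmbedding.ofStrictMono (fun i => ⟨s + i, by omega⟩) fun _ _ hab =>
    Fin.mk_lt_mk.2 (Nat.add_lt_add_left (Fin.lt_def.1 hab) s)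

/-- The pattern `beg_m(σ)` induced by the first `m` positions of `σ`. -/
def beginPat {n : ℕ} (m : ℕ) (h : m ≤ n) (σ : Equiv.Perm (Fin n)) : Equiv.Perm (Fin m) :=
  pat (intervalEmb 0 (by omega)) σ

/-- The pattern `end_m(σ)` induced by the last `m` positions of `σ`. -/
def endPat {n : ℕ} (m : ℕ) (h : m ≤ n) (σ : Equiv.Perm (Fin n)) : Equiv.Perm (Fin m) :=
  pat (intervalEmb (n - m) (by omega)) σ

/-- The number of consecutive occurrences of the pattern `π` (of size `k ≥ 1`) in `σ`:
the number of starting positions `s` for which the positions `s, …, s + k - 1` exist in `σ` and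
induce `π`. -/
noncomputable def consecutiveOcc {k n : ℕ} (π : Equiv.Perm (Fin k)) (σ : Equiv.Perm (Fin n)) : ℕ :=
  Set.ncard {s : ℕ | ∃ h : s + k ≤ n, pat (intervalEmb s h) σ = π}

/-- The proportion of consecutive occurrences of `π` in `σ` (normalized by the size of `σ`). -/
noncomputable def consecutiveProp {k n : ℕ} (π : Equiv.Perm (Fin k)) (σ : Equiv.Perm (Fin n)) : ℝ :=
  (consecutiveOcc π σ : ℝ) / (n : ℝ)

/-- Permutations of arbitrary finite size. -/
abbrev FinPerm : Type := Σ n : ℕ, Equiv.Perm (Fin n)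

/-- `σ` avoids all the patterns in `B`: no set of positions of `σ` (not necessarily an interval)
induces an element of `B`. -/
def Avoids (B : Set FinPerm) {n : ℕ} (σ : Equiv.Perm (Fin n)) : Prop :=
  ∀ τ ∈ B, ∀ f : Fin τ.1 ↪o Fin n, pat f σ ≠ τ.2

theorem Avoids.pat {B : Set FinPerm} {m n : ℕ} {σ : Equiv.Perm (Fin n)} (hσ : Avoids B σ)
    (f : Fin m ↪o Fin n) : Avoids B (pat f σ) := fun τ hτ g hg =>
  hσ τ hτ (g.trans f) (by rw [← hg, pat_pat])

/-- `Av_n(B)`, the type of `B`-avoiding permutations of size `n`. -/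
abbrev AvSize (B : Set FinPerm) (n : ℕ) : Type := {σ : Equiv.Perm (Fin n) // Avoids B σ}

/-- `Av(B)`, the set of `B`-avoiding permutations of arbitrary finite size `n ≥ 1`. -/
def Av (B : Set FinPerm) : Set FinPerm := {σ | 1 ≤ σ.1 ∧ Avoids B σ.2}

/-- The pattern-avoiding feasible region `P_k^{Av(B)}` for consecutive patterns of size `k`. -/
def feasibleRegion (B : Set FinPerm) (k : ℕ) : Set (Equiv.Perm (Fin k) → ℝ) :=
  {v | (∀ π, v π ∈ Set.Icc (0 : ℝ) 1) ∧
    ∃ σ : ℕ → FinPerm, (∀ m, σ m ∈ Av B) ∧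
      Tendsto (fun m => (σ m).1) atTop atTop ∧
      ∀ π : Equiv.Perm (Fin k),
        Tendsto (fun m => consecutiveProp π (σ m).2) atTop (𝓝 (v π))}

/-- A directed multigraph with vertex set `V` and edge set `E` (loops and parallel edges are
allowed): every edge has a starting vertex and an arrival vertex. -/
structure DirMultigraph (V E : Type*) where
  /-- the starting vertex of an edge -/
  st : E → V
  /-- the arrival vertex of an edge -/
  ar : E → V

namespace DirMultigraph

variable {V E : Type*}

/-- A walk is a sequence of edges, each one starting where the previous one arrives. -/
def IsWalk (G : DirMultigraph V E) (w : List E) : Prop :=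
  w.IsChain fun e e' => G.ar e = G.st e'

/-- A non-empty cycle: a non-empty walk that arrives where it starts. -/
def IsCycle (G : DirMultigraph V E) (w : List E) : Prop :=
  G.IsWalk w ∧ ∃ h : w ≠ [], G.st (w.head h) = G.ar (w.getLast h)

/-- A path: a walk `(e_1, …, e_r)` with distinct edges, whose successive vertices
`st e_1, …, st e_r, ar e_r` are distinct, except that the first and the last one may coincide.
This says that the starting vertices are distinct and the arrival vertices are distinct. -/
def IsPath (G : DirMultigraph V E) (w : List E) : Prop :=
  G.IsWalk w ∧ w.Nodup ∧ (w.map G.st).Nodup ∧ (w.map G.ar).Nodup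

/-- A simple cycle: a (non-empty) cycle that is a path. -/
def IsSimpleCycle (G : DirMultigraph V E) (w : List E) : Prop :=
  G.IsCycle w ∧ G.IsPath w

end DirMultigraph

/-- The vector `e_C` of a non-empty cycle `C`: its coordinate at an edge `e` is the number of
occurrences of `e` in `C` divided by the number of edges of `C`. -/
noncomputable def cycleVector {E : Type*} [DecidableEq E] (w : List E) : E → ℝ :=
  fun e => (w.count e : ℝ) / (w.length : ℝ)

/-- The cycle polytope of a directed multigraph. -/
def cyclePolytope {V E : Type*} [DecidableEq E] (G : DirMultigraph V E) : Set (E → ℝ) :=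
  convexHull ℝ {v | ∃ w : List E, G.IsSimpleCycle w ∧ v = cycleVector w}

/-- The overlap graph `Ov(k, Av(B))`, for `k ≥ 1`: the vertices are the elements of `Av_{k-1}(B)`,
and every `π` in `Av_k(B)` is (the label of) an edge, from the pattern of its first `k - 1`
positions to the pattern of its last `k - 1` positions. -/
def overlapGraph (B : Set FinPerm) (k : ℕ) : DirMultigraph (AvSize B (k - 1)) (AvSize B k) where
  st π := ⟨beginPat (k - 1) (Nat.sub_le k 1) π.1, π.2.pat _⟩
  ar π := ⟨endPat (k - 1) (Nat.sub_le k 1) π.1, π.2.pat _⟩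

/-- The embedding of the vectors indexed by `Av_k(B)` into the vectors indexed by all permutations
of size `k`, where the missing coordinates are `0`. -/
noncomputable def extendZero (B : Set FinPerm) (k : ℕ) (v : AvSize B k → ℝ) :
    Equiv.Perm (Fin k) → ℝ :=
  Function.extend Subtype.val v 0

/-- The permutation `312` (whose one-line notation is `2 0 1` when numbering from `0`). -/
def perm312 : Equiv.Perm (Fin 3) where
  toFun := ![2, 0, 1]
  invFun := ![1, 2, 0]
  left_inv := by decide
  right_inv := by decide

/-- The set of patterns `{312}`. -/
def B312 : Set FinPerm := {⟨3, perm312⟩}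

end ConsecutivePatterns

/-! Sliding a window of size `k` along a permutation traces a walk in the overlap graph, so pattern
counts are edge multiplicities of a walk. The boundary of such a vector has entries in {-1, 0, 1}.
After division by the size, every limit is therefore a nonnegative circulation of total mass 1, and
flow decomposition (`cyclePolytope_eq`) identifies these circulations with the points of the cycle
polytope.

The converse uses two properties of `Av(312)`. Every walk lifts to an avoiding permutation, because
one entry at a time can be added on the right (`exists_extension`). The overlap graph is strongly
connected, because the class is closed under direct sums (`exists_isWalkBetween_overlapGraph`).
Hence closed walks can wind around the simple cycles in any prescribed proportions, with a bounded
error from the connecting walks (`exists_walk_approx`).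

For the dimension, a strongly connected graph carries a strictly positive circulation, so only the
boundary and mass equations cut out the affine hull. This gives |E| - |V|, and `card_avoids_312`
evaluates both numbers. For the vertices, a unit circulation supported on a simple cycle must be the
vector of that cycle (`eq_cycleVector_of_support`), which makes each such vector extreme. -/

namespace ConsecutivePatterns

namespace DirMultigraph

/-! ### Walks with prescribed endpoints -/

section Walks

variable {V E : Type*}

/-- `w` is a (possibly empty) walk from `a` to `b`. -/
def IsWalkBetween (G : DirMultigraph V E) : V → List E → V → Prop
  | a, [], b => a = b
  | a, e :: w, b => G.st e = a ∧ G.IsWalkBetween (G.ar e) w b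

theorem IsWalkBetween.append {G : DirMultigraph V E} {w₁ w₂ : List E} {a b c : V}
    (h₁ : G.IsWalkBetween a w₁ b) (h₂ : G.IsWalkBetween b w₂ c) :
    G.IsWalkBetween a (w₁ ++ w₂) c := by
  induction w₁ generalizing a with
  | nil => cases h₁; exact h₂
  | cons e w ih => exact ⟨h₁.1, ih h₁.2⟩

theorem IsWalkBetween.exists_of_append {G : DirMultigraph V E} {w₁ w₂ : List E} {a c : V}
    (h : G.IsWalkBetween a (w₁ ++ w₂) c) :
    ∃ b, G.IsWalkBetween a w₁ b ∧ G.IsWalkBetween b w₂ c := by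
  induction w₁ generalizing a with
  | nil => exact ⟨a, rfl, h⟩
  | cons e w ih =>
    obtain ⟨b, hb, hc⟩ := ih h.2
    exact ⟨b, ⟨h.1, hb⟩, hc⟩

theorem IsWalk.isWalkBetween {G : DirMultigraph V E} {w : List E} (h : G.IsWalk w) (hw : w ≠ []) :
    G.IsWalkBetween (G.st (w.head hw)) w (G.ar (w.getLast hw)) := by
  induction w with
  | nil => exact absurd rfl hw
  | cons e w ih =>
    refine ⟨rfl, ?_⟩
    cases w with
    | nil => rfl
    | cons e' w =>
      have h' := List.isChain_cons_cons.1 h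
      have := ih h'.2 (by simp)
      simpa [h'.1] using this

theorem IsCycle.exists_isWalkBetween {G : DirMultigraph V E} {w : List E} (h : G.IsCycle w) :
    ∃ a, G.IsWalkBetween a w a := by
  obtain ⟨hw, hne, heq⟩ := h
  exact ⟨_, heq ▸ hw.isWalkBetween hne⟩

theorem IsWalkBetween.replicate {G : DirMultigraph V E} {w : List E} {a : V}
    (h : G.IsWalkBetween a w a) (N : ℕ) :
    G.IsWalkBetween a (List.replicate N w).flatten a := by
  induction N with
  | zero => rfl
  | succ N ih => exact h.append ih

end Walks

/-! ### The boundary map and unit circulations -/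

section Boundary

variable {V E : Type*} [Fintype E] [DecidableEq V]

/-- The boundary map, which sends a flow on the edges to its net inflow at every vertex. -/
noncomputable def boundary (G : DirMultigraph V E) : (E → ℝ) →ₗ[ℝ] (V → ℝ) :=
  Fintype.linearCombination ℝ fun e => Pi.single (G.ar e) (1 : ℝ) - Pi.single (G.st e) 1

theorem boundary_apply (G : DirMultigraph V E) (v : E → ℝ) (u : V) :
    G.boundary v u =
      (∑ e, if G.ar e = u then v e else 0) - ∑ e, if G.st e = u then v e else 0 := by
  simp [boundary, Fintype.linearCombination_apply, Finset.sum_apply, mul_sub, Pi.single_apply,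
    eq_comm]

theorem boundary_single [DecidableEq E] (G : DirMultigraph V E) (e : E) :
    G.boundary (Pi.single e 1) = Pi.single (G.ar e) 1 - Pi.single (G.st e) 1 := by
  simp [boundary, Fintype.linearCombination_apply_single]

theorem sum_boundary [Fintype V] (G : DirMultigraph V E) (v : E → ℝ) :
    ∑ u, G.boundary v u = 0 := by
  simp only [boundary_apply, Finset.sum_sub_distrib]
  rw [Finset.sum_comm, Finset.sum_comm (s := Finset.univ (α := V))]
  simp

/-- The vector of multiplicities of the edges of a walk. -/
def multiplicity [DecidableEq E] (w : List E) : E → ℝ := fun e => (w.count e : ℝ)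

omit [Fintype E] in
theorem multiplicity_cons [DecidableEq E] (e : E) (w : List E) :
    multiplicity (e :: w) = Pi.single e 1 + multiplicity w := by
  ext f
  simp only [multiplicity, List.count_cons, Pi.add_apply, Pi.single_apply]
  by_cases h : e = f
  · subst h; simp [add_comm]
  · simp [h, Ne.symm h]

omit [Fintype E] in
theorem multiplicity_append [DecidableEq E] (w₁ w₂ : List E) :
    multiplicity (w₁ ++ w₂) = multiplicity w₁ + multiplicity w₂ := by
  ext f; simp [multiplicity]

omit [Fintype E] in
theorem multiplicity_replicate [DecidableEq E] (w : List E) (N : ℕ) :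
    multiplicity (List.replicate N w).flatten = (N : ℝ) • multiplicity w := by
  ext f; simp [multiplicity, List.count_flatten]

theorem sum_multiplicity [DecidableEq E] (w : List E) :
    ∑ e, multiplicity w e = w.length := by
  induction w with
  | nil => simp [multiplicity]
  | cons e w ih => simp [multiplicity_cons, Finset.sum_add_distrib, ih, add_comm]

theorem IsWalkBetween.boundary_multiplicity [DecidableEq E] {G : DirMultigraph V E} {w : List E}
    {a b : V} (h : G.IsWalkBetween a w b) :
    G.boundary (multiplicity w) = Pi.single b 1 - Pi.single a 1 := by
  induction w generalizing a with
  | nil =>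
    cases h
    have : multiplicity ([] : List E) = 0 := by ext; simp [multiplicity]
    simp [this]
  | cons e w ih =>
    rw [multiplicity_cons, map_add, ih h.2, boundary_single, h.1]
    abel

omit [Fintype E] in
theorem cycleVector_eq_smul [DecidableEq E] (w : List E) :
    cycleVector w = (w.length : ℝ)⁻¹ • multiplicity w := by
  ext e; simp [cycleVector, multiplicity, div_eq_inv_mul]

/-- The nonnegative circulations of total mass `1`. -/
def unitCirculations (G : DirMultigraph V E) : Set (E → ℝ) :=
  {v | (∀ e, 0 ≤ v e) ∧ G.boundary v = 0 ∧ ∑ e, v e = 1}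

theorem convex_unitCirculations (G : DirMultigraph V E) : Convex ℝ G.unitCirculations := by
  rintro x ⟨hx, hx', hx''⟩ y ⟨hy, hy', hy''⟩ a b ha hb hab
  refine ⟨fun e => ?_, by simp [hx', hy'], ?_⟩
  · exact add_nonneg (mul_nonneg ha (hx e)) (mul_nonneg hb (hy e))
  · simp [Finset.sum_add_distrib, ← Finset.mul_sum, hx'', hy'', hab]

theorem IsCycle.cycleVector_mem [DecidableEq E] {G : DirMultigraph V E} {w : List E}
    (h : G.IsCycle w) : cycleVector w ∈ G.unitCirculations := by
  obtain ⟨a, ha⟩ := h.exists_isWalkBetween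
  have hl : (w.length : ℝ) ≠ 0 := by simpa using h.2.1
  refine ⟨fun e => by simp only [cycleVector]; positivity, ?_, ?_⟩
  · rw [cycleVector_eq_smul, map_smul, ha.boundary_multiplicity]; simp
  · simp [cycleVector_eq_smul, ← Finset.mul_sum, sum_multiplicity, hl]

end Boundary

/-! ### Flow decomposition and extreme points of the cycle polytope -/

section Decomposition

variable {V E : Type*} [Fintype E] [DecidableEq V]

/-- Flow conservation at `G.ar e`: the inflow is at least `v e > 0`, so some outgoing edge carries
flow. This lets one keep walking inside the support. -/
theorem exists_pos_of_boundary_eq_zero {G : DirMultigraph V E} {v : E → ℝ} (hv : ∀ e, 0 ≤ v e)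
    (hb : G.boundary v = 0) {e : E} (he : 0 < v e) : ∃ e', G.st e' = G.ar e ∧ 0 < v e' := by
  by_contra! H
  have h := congrFun hb (G.ar e)
  rw [boundary_apply, Pi.zero_apply, sub_eq_zero] at h
  have h₂ : ∑ f, (if G.st f = G.ar e then v f else 0) = 0 :=
    Finset.sum_eq_zero fun f _ => by
      split_ifs with hf
      · exact le_antisymm (H f hf) (hv f)
      · rfl
  have h₁ : v e ≤ ∑ f, (if G.ar f = G.ar e then v f else 0) := by
    have := Finset.single_le_sum (f := fun f => if G.ar f = G.ar e then v f else 0)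
      (fun f _ => by split_ifs <;> simp [hv f]) (Finset.mem_univ e)
    simpa using this
  linarith

/-- A nonzero nonnegative circulation has a simple cycle in its support. -/
theorem exists_isSimpleCycle [Finite V] {G : DirMultigraph V E} {v : E → ℝ} (hv : ∀ e, 0 ≤ v e)
    (hb : G.boundary v = 0) {e₀ : E} (he₀ : 0 < v e₀) :
    ∃ w, G.IsSimpleCycle w ∧ ∀ e ∈ w, 0 < v e := by
  classical
  -- Follow a chosen positive edge `g u` out of each good vertex; `e₀` is only a default value at
  -- the other vertices. The map `T` preserves good vertices, so by finiteness its orbit becomes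
  -- periodic, and one minimal period is the simple cycle.
  let good : V → Prop := fun u => ∃ e, G.st e = u ∧ 0 < v e
  let g : V → E := fun u => if h : good u then h.choose else e₀
  have hg : ∀ u, good u → G.st (g u) = u ∧ 0 < v (g u) := fun u hu => by
    simp only [g, dif_pos hu]; exact hu.choose_spec
  let T : V → V := fun u => G.ar (g u)
  have hT : ∀ u, good u → good (T u) := fun u hu =>
    exists_pos_of_boundary_eq_zero hv hb (hg u hu).2
  have hTi : ∀ i u, good u → good (T^[i] u) := fun i => by
    induction i with
    | zero => exact fun u hu => hu
    | succ i ih => exact fun u hu => ih _ (hT u hu)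
  obtain ⟨i, j, hij, heq⟩ := Finite.exists_ne_map_eq_of_infinite fun i : ℕ => T^[i] (G.st e₀)
  wlog hlt : i < j generalizing i j
  · exact this j i hij.symm heq.symm (by omega)
  set u := T^[i] (G.st e₀) with hu
  have hgood : good u := hTi _ _ ⟨e₀, rfl, he₀⟩
  have hper : u ∈ Function.periodicPts T := by
    refine ⟨j - i, by omega, ?_⟩
    change T^[j - i] u = u
    rw [hu, ← Function.iterate_add_apply]
    simpa [Nat.sub_add_cancel hlt.le] using heq.symm
  set p := Function.minimalPeriod T u with hp
  have hp0 : 0 < p := Function.minimalPeriod_pos_of_mem_periodicPts hper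
  have hinj : ∀ a < p, ∀ b < p, T^[a] u = T^[b] u → a = b := fun a ha b hb h =>
    Function.iterate_injOn_Iio_minimalPeriod (by simpa using ha) (by simpa using hb) h
  have hst : ∀ a, G.st (g (T^[a] u)) = T^[a] u := fun a => (hg _ (hTi a u hgood)).1
  have har : ∀ a, G.ar (g (T^[a] u)) = T^[a + 1] u := fun a => by
    rw [Function.iterate_succ_apply']
  -- The arrival vertices are the starting vertices shifted by one step; reducing indices modulo the
  -- period brings them back to the range of `hinj`.
  have hinj' : ∀ a < p, ∀ b < p, T^[a + 1] u = T^[b + 1] u → a = b := by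
    have key : ∀ a < p, T^[a + 1] u = T^[(a + 1) % p] u := fun a _ => by
      rw [Function.iterate_mod_minimalPeriod_eq]
    intro a ha b hb h
    rw [key a ha, key b hb] at h
    have h := hinj _ (Nat.mod_lt _ hp0) _ (Nat.mod_lt _ hp0) h
    exact Nat.ModEq.eq_of_lt_of_lt (Nat.ModEq.add_right_cancel' 1 h) ha hb
  let w := (List.range p).map fun a => g (T^[a] u)
  have hstw : (w.map G.st).Nodup := by
    simp only [w, List.map_map]
    refine List.Nodup.map_on ?_ List.nodup_range
    intro a ha b hb h
    simp only [Function.comp, hst] at h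
    exact hinj a (by simpa using ha) b (by simpa using hb) h
  have harw : (w.map G.ar).Nodup := by
    simp only [w, List.map_map]
    refine List.Nodup.map_on ?_ List.nodup_range
    intro a ha b hb h
    simp only [Function.comp, har] at h
    exact hinj' a (by simpa using ha) b (by simpa using hb) h
  have hwalk : G.IsWalk w := by
    unfold IsWalk
    rw [List.isChain_iff_getElem]
    intro a ha
    simp only [w, List.getElem_map, List.getElem_range, hst, har]
  have hwne : w ≠ [] := by simp [w, hp0.ne']
  refine ⟨w, ⟨⟨hwalk, hwne, ?_⟩, hwalk, hstw.of_map, hstw, harw⟩, ?_⟩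
  · rw [List.head_eq_getElem, List.getLast_eq_getElem]
    simp only [w, List.getElem_map, List.getElem_range, hst, har, List.length_map,
      List.length_range, Nat.sub_add_cancel hp0]
    exact (Function.isPeriodicPt_minimalPeriod T u).symm
  · intro e he
    obtain ⟨a, -, rfl⟩ := List.mem_map.1 he
    exact (hg _ (hTi a u hgood)).2

/-- Greedy removal of cycles: subtract the largest multiple of a simple cycle in the support that
keeps the flow nonnegative. At least one edge leaves the support, and induction on its size applies.
The mass is left arbitrary because the remainder no longer has mass 1. -/
theorem exists_smul_mem_cyclePolytope [Finite V] [DecidableEq E] (G : DirMultigraph V E) {v : E → ℝ}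
    (hv : ∀ e, 0 ≤ v e) (hb : G.boundary v = 0) (hne : v ≠ 0) :
    ∃ x ∈ cyclePolytope G, v = (∑ e, v e) • x := by
  induction hn : (Finset.univ.filter fun e => 0 < v e).card using Nat.strong_induction_on
    generalizing v with
  | _ n ih =>
  obtain ⟨e₀, he₀⟩ : ∃ e, 0 < v e := by
    by_contra! H
    exact hne (funext fun e => le_antisymm (H e) (hv e))
  obtain ⟨w, hw, hpos⟩ := exists_isSimpleCycle hv hb he₀
  have hwne := hw.1.2.1
  have hl : (0 : ℝ) < w.length := by
    have := List.length_pos_of_ne_nil hwne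
    exact_mod_cast this
  -- The bottleneck edge of the cycle. The factor `w.length` in `c` cancels the normalization of
  -- `cycleVector`, so exactly `v e₁` is removed from each edge of `w`.
  obtain ⟨e₁, he₁, hmin⟩ := Finset.exists_min_image w.toFinset v
    ⟨w.head hwne, by simp⟩
  rw [List.mem_toFinset] at he₁
  have hcv : cycleVector w ∈ cyclePolytope G := subset_convexHull _ _ ⟨w, hw, rfl⟩
  set c := v e₁ * w.length with hc
  have hc0 : 0 < c := mul_pos (hpos _ he₁) hl
  set v' := v - c • cycleVector w with hv'
  obtain ⟨-, hcb, hcs⟩ := hw.1.cycleVector_mem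
  have hcve : ∀ e, c * cycleVector w e = if e ∈ w then v e₁ else 0 := fun e => by
    have : (w.count e : ℝ) = if e ∈ w then 1 else 0 := by
      split_ifs with h
      · exact_mod_cast List.count_eq_one_of_mem hw.2.2.1 h
      · exact_mod_cast List.count_eq_zero_of_not_mem h
    simp only [cycleVector, this, hc]
    split_ifs <;> field_simp
    simp
  have hv'e : ∀ e, v' e = v e - if e ∈ w then v e₁ else 0 := fun e => by
    simp [hv', hcve]
  have hv'0 : ∀ e, 0 ≤ v' e := fun e => by
    rw [hv'e]
    split_ifs with h
    · linarith [hmin e (by simpa using h)]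
    · simpa using hv e
  have hv'b : G.boundary v' = 0 := by simp [hv', hb, hcb]
  have hdecomp : v = c • cycleVector w + v' := by simp [hv']
  have hsum : ∑ e, v e = c + ∑ e, v' e := by
    conv_lhs => rw [hdecomp]
    simp [Finset.sum_add_distrib, ← Finset.mul_sum, hcs]
  by_cases h0 : v' = 0
  · refine ⟨_, hcv, ?_⟩
    rw [hsum, h0]
    simp [hdecomp, h0]
  obtain ⟨x, hx, hvx⟩ := ih _ (by
    rw [← hn]
    refine Finset.card_lt_card (Finset.ssubset_iff_of_subset ?_ |>.2 ⟨e₁, ?_, ?_⟩)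
    · intro e he
      simp only [Finset.mem_filter, Finset.mem_univ, true_and] at he ⊢
      rw [hv'e] at he
      have := hpos _ he₁
      split_ifs at he <;> linarith
    · simpa using hpos _ he₁
    · simp [hv'e, he₁]) hv'0 hv'b h0 rfl
  have hs0 : 0 ≤ ∑ e, v' e := Finset.sum_nonneg fun e _ => hv'0 e
  set s := ∑ e, v' e
  refine ⟨(c / (c + s)) • cycleVector w + (s / (c + s)) • x,
    convex_convexHull ℝ _ hcv hx (by positivity) (by positivity) (by field_simp), ?_⟩
  rw [hsum, smul_add, smul_smul, smul_smul, mul_div_cancel₀ _ (by positivity),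
    mul_div_cancel₀ _ (by positivity), ← hvx]
  exact hdecomp

/-- The cycle polytope consists of the unit circulations. -/
theorem cyclePolytope_eq [Finite V] [DecidableEq E] (G : DirMultigraph V E) :
    cyclePolytope G = G.unitCirculations := by
  apply Set.Subset.antisymm
  · refine convexHull_min ?_ G.convex_unitCirculations
    rintro _ ⟨w, hw, rfl⟩
    exact hw.1.cycleVector_mem
  · rintro v ⟨hv, hb, hs⟩
    obtain ⟨x, hx, hvx⟩ := G.exists_smul_mem_cyclePolytope hv hb (by rintro rfl; simp at hs)
    rw [hvx, hs, one_smul]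
    exact hx

/-- The only unit circulation supported on a simple cycle is the vector of the cycle. -/
theorem eq_cycleVector_of_support [DecidableEq E] {G : DirMultigraph V E} {w : List E}
    (hw : G.IsSimpleCycle w) {v : E → ℝ} (hv : v ∈ G.unitCirculations)
    (hsupp : ∀ e ∉ w, v e = 0) : v = cycleVector w := by
  -- At a vertex of the cycle, only one edge of `w` enters and only one leaves; all other edges
  -- carry no flow. Conservation thus equates the flows on consecutive edges.
  have hstep : ∀ e ∈ w, ∀ e' ∈ w, G.ar e = G.st e' → v e = v e' := by
    intro e he e' he' h
    have hb := congrFun hv.2.1 (G.ar e)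
    rw [boundary_apply, Pi.zero_apply, sub_eq_zero, Finset.sum_eq_single e,
      Finset.sum_eq_single e'] at hb
    · simpa [h] using hb
    · intro f _ hf
      by_cases hfw : f ∈ w
      · rw [if_neg]
        intro hf'
        exact hf (List.inj_on_of_nodup_map hw.2.2.2.1 hfw he' (hf'.trans h))
      · simp [hsupp f hfw]
    · simp
    · intro f _ hf
      by_cases hfw : f ∈ w
      · rw [if_neg]
        intro hf'
        exact hf (List.inj_on_of_nodup_map hw.2.2.2.2 hfw he hf')
      · simp [hsupp f hfw]
    · simp
  have hl : 0 < w.length := List.length_pos_of_ne_nil hw.1.2.1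
  have hconst : ∀ i (hi : i < w.length), v w[i] = v w[0] := by
    intro i
    induction i with
    | zero => exact fun _ => rfl
    | succ i ih =>
      intro hi
      rw [← ih (by omega)]
      exact (hstep _ (List.getElem_mem _) _ (List.getElem_mem _)
        (List.isChain_iff_getElem.1 hw.1.1 i hi)).symm
  have hmult : v = v w[0] • multiplicity w := by
    ext e
    by_cases he : e ∈ w
    · obtain ⟨i, hi, rfl⟩ := List.getElem_of_mem he
      simp [multiplicity, List.count_eq_one_of_mem hw.2.2.1 (List.getElem_mem hi), hconst i hi]
    · simp [multiplicity, List.count_eq_zero_of_not_mem he, hsupp e he]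
  have hs := hv.2.2
  rw [hmult] at hs
  simp only [Pi.smul_apply, smul_eq_mul, ← Finset.mul_sum, sum_multiplicity] at hs
  rw [hmult, cycleVector_eq_smul, eq_inv_of_mul_eq_one_left hs]

/-- The extreme points of the cycle polytope are the vectors of the simple cycles. -/
theorem extremePoints_cyclePolytope [Finite V] [DecidableEq E] (G : DirMultigraph V E) :
    Set.extremePoints ℝ (cyclePolytope G) =
      {v | ∃ w : List E, G.IsSimpleCycle w ∧ v = cycleVector w} := by
  apply Set.Subset.antisymm
  · exact extremePoints_convexHull_subset
  · rintro _ ⟨w, hw, rfl⟩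
    rw [cyclePolytope_eq]
    refine ⟨hw.1.cycleVector_mem, ?_⟩
    intro x hx y hy ⟨a, b, ha, hb, _, hxy⟩
    -- Off `w` the combination of the nonnegative `x` and `y` vanishes, and since `a > 0`, so does
    -- `x`.
    refine eq_cycleVector_of_support hw hx fun e he => ?_
    have h := congrFun hxy e
    simp only [Pi.add_apply, Pi.smul_apply, smul_eq_mul, cycleVector,
      List.count_eq_zero_of_not_mem he, Nat.cast_zero, zero_div] at h
    have h₁ := mul_nonneg ha.le (hx.1 e)
    have h₂ := mul_nonneg hb.le (hy.1 e)
    exact (mul_eq_zero.1 (by linarith : a * x e = 0)).resolve_left ha.ne'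

end Decomposition

/-! ### Strongly connected multigraphs: dimension and approximation by closed walks -/

section StronglyConnected

variable {V E : Type*} [Fintype E] [DecidableEq V]

/-- Every edge lies on a closed walk; add up one such walk per edge and normalize. -/
theorem exists_pos_mem_unitCirculations [DecidableEq E] [Nonempty E] {G : DirMultigraph V E}
    (hG : ∀ a b, ∃ w, G.IsWalkBetween a w b) : ∃ p ∈ G.unitCirculations, ∀ e, 0 < p e := by
  choose W hW using hG
  let C : E → List E := fun e => e :: W (G.ar e) (G.st e)
  have hC : ∀ e, G.IsWalkBetween (G.st e) (C e) (G.st e) := fun e => ⟨rfl, hW _ _⟩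
  let q : E → ℝ := ∑ e, multiplicity (C e)
  have hq : ∀ e, 0 < q e := fun e => by
    have h := Finset.single_le_sum (f := fun f => multiplicity (C f) e)
      (fun f _ => by simp [multiplicity]) (Finset.mem_univ e)
    have h' : 0 < multiplicity (C e) e := by
      simp only [multiplicity, C, List.count_cons_self]; positivity
    simpa [q] using h'.trans_le h
  have hqb : G.boundary q = 0 := by
    simp [q, map_sum, (hC _).boundary_multiplicity]
  have hqs : 0 < ∑ e, q e := Finset.sum_pos (fun e _ => hq e) Finset.univ_nonempty
  refine ⟨(∑ e, q e)⁻¹ • q, ⟨fun e => ?_, by simp [hqb], ?_⟩, fun e => ?_⟩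
  · exact mul_nonneg (inv_nonneg.2 hqs.le) (hq e).le
  · simp [← Finset.mul_sum, hqs.ne']
  · exact mul_pos (inv_pos.2 hqs) (hq e)

/-- The cycle polytope of a strongly connected multigraph has dimension `|E| - |V|`. -/
theorem finrank_vectorSpan_unitCirculations [DecidableEq E] [Nonempty E] [Fintype V]
    {G : DirMultigraph V E} (hG : ∀ a b, ∃ w, G.IsWalkBetween a w b) :
    Module.finrank ℝ (vectorSpan ℝ G.unitCirculations) + Fintype.card V = Fintype.card E := by
  obtain ⟨p, hp, hp0⟩ := exists_pos_mem_unitCirculations hG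
  let a₀ : V := G.st (Classical.arbitrary E)
  let S : (E → ℝ) →ₗ[ℝ] ℝ := Fintype.linearCombination ℝ fun _ => (1 : ℝ)
  have hS : ∀ v, S v = ∑ e, v e := fun v => by simp [S, Fintype.linearCombination_apply]
  -- Boundary entries always sum to 0, so the mass can be stored at `a₀` without losing information:
  -- summing the entries of `D v` recovers it. One surjective map onto `V → ℝ` then encodes all the
  -- equations, and rank-nullity gives |E| - |V|.
  let D : (E → ℝ) →ₗ[ℝ] (V → ℝ) := G.boundary + S.smulRight (Pi.single a₀ 1)
  have hD : ∀ v, D v = G.boundary v + (∑ e, v e) • Pi.single a₀ 1 := fun v => by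
    simp [D, hS]
  have hker : ∀ v, v ∈ LinearMap.ker D ↔ G.boundary v = 0 ∧ ∑ e, v e = 0 := fun v => by
    rw [LinearMap.mem_ker, hD]
    refine ⟨fun h => ?_, fun ⟨h, h'⟩ => by simp [h, h']⟩
    have hs : ∑ e, v e = 0 := by
      have := congrArg (fun x : V → ℝ => ∑ u, x u) h
      simpa [Finset.sum_add_distrib, sum_boundary, ← Finset.mul_sum] using this
    exact ⟨by simpa [hs] using h, hs⟩
  have hspan : vectorSpan ℝ G.unitCirculations = LinearMap.ker D := by
    apply le_antisymm
    · rw [vectorSpan, Submodule.span_le]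
      rintro _ ⟨x, hx, y, hy, rfl⟩
      rw [SetLike.mem_coe, hker]
      simp [hx.2.1, hy.2.1, hx.2.2, hy.2.2]
    · intro v hv
      rw [hker] at hv
      -- As `p` is positive on every edge, a small step from `p` in the direction `v` stays
      -- nonnegative; hence `v` is a multiple of a difference of two unit circulations.
      obtain ⟨ε, hε, hεv⟩ : ∃ ε > 0, ∀ e, ε * |v e| ≤ p e := by
        obtain ⟨e₁, -, he₁⟩ := Finset.exists_min_image Finset.univ p Finset.univ_nonempty
        obtain ⟨e₂, -, he₂⟩ := Finset.exists_max_image Finset.univ (fun e => |v e|)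
          Finset.univ_nonempty
        have h0 : 0 < |v e₂| + 1 := by positivity
        refine ⟨p e₁ / (|v e₂| + 1), div_pos (hp0 _) h0, fun e => ?_⟩
        calc p e₁ / (|v e₂| + 1) * |v e| ≤ p e₁ / (|v e₂| + 1) * (|v e₂| + 1) := by
              have := he₂ e (Finset.mem_univ _)
              exact mul_le_mul_of_nonneg_left (by linarith) (div_pos (hp0 _) h0).le
          _ = p e₁ := by field_simp
          _ ≤ p e := he₁ e (Finset.mem_univ _)
      have hmem : p + ε • v ∈ G.unitCirculations := by
        refine ⟨fun e => ?_, by simp [hp.2.1, hv.1], ?_⟩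
        · have h₁ := hεv e
          have h₂ := mul_le_mul_of_nonneg_left (neg_abs_le (v e)) hε.le
          simp only [Pi.add_apply, Pi.smul_apply, smul_eq_mul]
          linarith
        · simp [Finset.sum_add_distrib, ← Finset.mul_sum, hp.2.2, hv.2]
      have h := vsub_mem_vectorSpan ℝ hmem hp
      have h' := Submodule.smul_mem _ ε⁻¹ h
      simpa [smul_smul, hε.ne'] using h'
  have hsurj : LinearMap.range D = ⊤ := by
    have hbase : Pi.single a₀ 1 ∈ LinearMap.range D := ⟨p, by simp [hD, hp.2.1, hp.2.2]⟩
    -- A walk from `a₀` to `u` has boundary `u - a₀`; the mass term and the missing `a₀` are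
    -- corrected with `hbase`.
    have hsingle : ∀ u, Pi.single u 1 ∈ LinearMap.range D := fun u => by
      obtain ⟨w, hw⟩ := hG a₀ u
      have h : D (multiplicity w) ∈ LinearMap.range D := ⟨_, rfl⟩
      rw [hD, hw.boundary_multiplicity] at h
      have h' := Submodule.add_mem _ (Submodule.sub_mem _ h
        (Submodule.smul_mem _ (∑ e, multiplicity w e) hbase)) hbase
      simpa using h'
    rw [eq_top_iff, ← (Pi.basisFun ℝ V).span_eq, Submodule.span_le]
    rintro _ ⟨u, rfl⟩
    simpa using hsingle u
  have h := LinearMap.finrank_range_add_finrank_ker D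
  rw [hsurj, finrank_top, Module.finrank_fintype_fun_eq_card,
    Module.finrank_fintype_fun_eq_card] at h
  rw [hspan]
  omega

omit [DecidableEq V] in
/-- In a strongly connected multigraph, the multiples of a unit circulation are approximated,
up to a bounded error, by closed walks through any given vertex. -/
theorem exists_walk_approx [DecidableEq E] {G : DirMultigraph V E}
    (hG : ∀ a b, ∃ w, G.IsWalkBetween a w b) (a : V) {v : E → ℝ} (hv : v ∈ cyclePolytope G) :
    ∃ K : ℝ, ∀ N : ℕ, ∃ w, G.IsWalkBetween a w a ∧ ∀ e, |multiplicity w e - N * v e| ≤ K := by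
  -- The approximable vectors form a convex cone: closed walks based at the common vertex `a` can be
  -- concatenated. It remains to see that it contains the multiplicity vectors of cycles.
  let A : Set (E → ℝ) := {v | ∃ K : ℝ, ∀ N : ℕ, ∃ w, G.IsWalkBetween a w a ∧
    ∀ e, |multiplicity w e - N * v e| ≤ K}
  have hadd : ∀ x ∈ A, ∀ y ∈ A, x + y ∈ A := by
    rintro x ⟨K, hK⟩ y ⟨L, hL⟩
    refine ⟨K + L, fun N => ?_⟩
    obtain ⟨w, hw, hwe⟩ := hK N
    obtain ⟨w', hw', hwe'⟩ := hL N
    refine ⟨w ++ w', hw.append hw', fun e => ?_⟩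
    rw [multiplicity_append]
    calc _ = |(multiplicity w e - N * x e) + (multiplicity w' e - N * y e)| := by
          congr 1; simp only [Pi.add_apply]; ring
      _ ≤ _ := (abs_add_le _ _).trans (add_le_add (hwe e) (hwe' e))
  have hsmul : ∀ c : ℝ, 0 ≤ c → ∀ x ∈ A, c • x ∈ A := by
    rintro c hc x ⟨K, hK⟩
    refine ⟨K + ∑ e, |x e|, fun N => ?_⟩
    -- Rounding `N * c` down costs at most `|x e|` at the edge `e`, uniformly in `N`.
    obtain ⟨w, hw, hwe⟩ := hK ⌊N * c⌋₊
    refine ⟨w, hw, fun e => ?_⟩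
    have h₁ : |(⌊N * c⌋₊ : ℝ) - N * c| ≤ 1 := by
      have h1 := Nat.floor_le (mul_nonneg N.cast_nonneg hc : (0 : ℝ) ≤ N * c)
      have h2 := Nat.lt_floor_add_one ((N : ℝ) * c)
      rw [abs_le]; constructor <;> linarith
    have h₂ : |x e| ≤ ∑ e, |x e| :=
      Finset.single_le_sum (f := fun e => |x e|) (fun _ _ => abs_nonneg _) (Finset.mem_univ e)
    calc _ = |(multiplicity w e - ⌊N * c⌋₊ * x e) + ((⌊N * c⌋₊ : ℝ) - N * c) * x e| := by
          congr 1; simp only [Pi.smul_apply, smul_eq_mul]; ring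
      _ ≤ K + 1 * |x e| := by
          refine (abs_add_le _ _).trans (add_le_add (hwe e) ?_)
          rw [abs_mul]
          exact mul_le_mul_of_nonneg_right h₁ (abs_nonneg _)
      _ ≤ _ := by linarith
  have hcycle : ∀ w, G.IsCycle w → multiplicity w ∈ A := by
    intro w hw
    obtain ⟨b, hb⟩ := hw.exists_isWalkBetween
    obtain ⟨w₁, hw₁⟩ := hG a b
    obtain ⟨w₂, hw₂⟩ := hG b a
    -- Go from `a` to the cycle, turn `N` times and come back; the error is only the two connecting
    -- walks.
    refine ⟨∑ e, (multiplicity w₁ e + multiplicity w₂ e), fun N =>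
      ⟨w₁ ++ ((List.replicate N w).flatten ++ w₂), hw₁.append ((hb.replicate N).append hw₂),
        fun e => ?_⟩⟩
    have h0 : ∀ (l : List E) e, 0 ≤ multiplicity l e := fun l e => by simp [multiplicity]
    rw [multiplicity_append, multiplicity_append, multiplicity_replicate]
    have h := Finset.single_le_sum (f := fun e => multiplicity w₁ e + multiplicity w₂ e)
      (fun e _ => add_nonneg (h0 _ _) (h0 _ _)) (Finset.mem_univ e)
    refine le_trans (le_of_eq ?_) h
    simp only [Pi.add_apply, Pi.smul_apply, smul_eq_mul]
    rw [← abs_of_nonneg (add_nonneg (h0 w₁ e) (h0 w₂ e))]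
    congr 1; ring
  have hconv : Convex ℝ A := fun x hx y hy s t hs ht _ =>
    hadd _ (hsmul s hs x hx) _ (hsmul t ht y hy)
  refine convexHull_min ?_ hconv hv
  rintro _ ⟨w, hw, rfl⟩
  rw [cycleVector_eq_smul]
  exact hsmul _ (by positivity) _ (hcycle w hw.1)

end StronglyConnected

end DirMultigraph

/-! ### Patterns and extensions of 312-avoiding permutations -/

theorem eq_pat_iff {m n : ℕ} (f : Fin m ↪o Fin n) (σ : Equiv.Perm (Fin n))
    (π : Equiv.Perm (Fin m)) : pat f σ = π ↔ ∀ i j, π i < π j ↔ σ (f i) < σ (f j) := by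
  constructor
  · rintro rfl i j
    exact pat_lt_pat_iff f σ i j
  · exact fun h => std_eq_of_lt_iff (σ.injective.comp f.injective) h

theorem val_intervalEmb {m n s : ℕ} (h : s + m ≤ n) (i : Fin m) :
    (intervalEmb s h i : ℕ) = s + i := rfl

theorem pat_intervalEmb_pat {l m n s t : ℕ} (h : s + l ≤ m) (h' : t + m ≤ n)
    (σ : Equiv.Perm (Fin n)) :
    pat (intervalEmb s h) (pat (intervalEmb t h') σ) =
      pat (intervalEmb (t + s) (by omega : t + s + l ≤ n)) σ := by
  rw [pat_pat]
  congr 1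
  ext i
  simp [val_intervalEmb, add_assoc]

theorem avoids_312_iff {n : ℕ} {σ : Equiv.Perm (Fin n)} :
    Avoids B312 σ ↔ ∀ a b c, a < b → b < c → σ b < σ c → σ c < σ a → False := by
  constructor
  · intro h a b c hab hbc h₁ h₂
    have hmono : StrictMono ![a, b, c] := by
      rw [Fin.strictMono_iff_lt_succ]
      intro i
      fin_cases i
      · exact hab
      · exact hbc
    refine h ⟨3, perm312⟩ rfl (OrderEmbedding.ofStrictMono _ hmono) ((eq_pat_iff _ _ _).2 ?_)
    intro i j
    have h₃ := h₁.trans h₂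
    fin_cases i <;> fin_cases j <;>
      simp [perm312, h₁, h₂, h₃, h₁.le, h₂.le, h₃.le]
  · rintro h _ rfl f hf
    have hf := (eq_pat_iff f σ perm312).1 hf
    refine h (f 0) (f 1) (f 2) (f.strictMono (by decide)) (f.strictMono (by decide))
      ((hf 1 2).1 (by decide)) ((hf 2 0).1 (by decide))

/-- The permutation whose values are in the order of an injective sequence avoids `312` if the
sequence does. -/
theorem avoids_312_std {n : ℕ} {α : Type*} [LinearOrder α] {x : Fin n → α}
    (hx : Function.Injective x)
    (h : ∀ a b c, a < b → b < c → x b < x c → x c < x a → False) : Avoids B312 (std x) := by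
  rw [avoids_312_iff]
  intro a b c hab hbc h₁ h₂
  rw [std_lt_std_iff hx] at h₁ h₂
  exact h a b c hab hbc h₁ h₂

/-- A `312`-avoiding permutation can be extended on the right by one entry in such a way that the
last entries form a prescribed compatible `312`-avoiding pattern. -/
theorem exists_extension {n j : ℕ} (hj : j ≤ n) {σ : Equiv.Perm (Fin n)} (hσ : Avoids B312 σ)
    {π : Equiv.Perm (Fin (j + 1))} (hπ : Avoids B312 π)
    (h : pat (intervalEmb 0 (by omega : 0 + j ≤ j + 1)) π =
      pat (intervalEmb (n - j) (by omega : n - j + j ≤ n)) σ) :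
    ∃ σ' : Equiv.Perm (Fin (n + 1)), Avoids B312 σ' ∧
      pat (intervalEmb 0 (by omega : 0 + n ≤ n + 1)) σ' = σ ∧
      pat (intervalEmb (n - j) (by omega : n - j + (j + 1) ≤ n + 1)) σ' = π := by
  have hlt : ∀ a b : Fin j, π a.castSucc < π b.castSucc ↔
      σ ⟨n - j + a, by omega⟩ < σ ⟨n - j + b, by omega⟩ := by
    intro a b
    have := (eq_pat_iff _ _ _).1 h.symm a b
    rw [pat_lt_pat_iff] at this
    have hc : ∀ a : Fin j, intervalEmb 0 (by omega : 0 + j ≤ j + 1) a = a.castSucc := fun a => by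
      ext; simp [val_intervalEmb]
    rw [hc, hc] at this
    exact this
  rw [avoids_312_iff] at hσ hπ
  -- `t` is the value of the new entry, with respect to the values of `σ`
  obtain ⟨t, ht₁, ht₂⟩ : ∃ t : ℕ,
      (∀ a : Fin j, (σ ⟨n - j + a, by omega⟩ : ℕ) < t ↔ π a.castSucc < π (Fin.last j)) ∧
      (∀ a b : Fin n, a < b → (σ b : ℕ) < t → t ≤ σ a → False) := by
    -- The new entry goes just below the smallest of the last `j` values of `σ` that `π` requires to
    -- be above it, or on top of everything if there are none.
    rcases Finset.eq_empty_or_nonempty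
      (Finset.univ.filter fun a : Fin j => π (Fin.last j) < π a.castSucc) with hU | hU
    · refine ⟨n, fun a => ⟨fun _ => ?_, fun _ => by omega⟩, fun a b _ _ h => by omega⟩
      have := Finset.filter_eq_empty_iff.1 hU (Finset.mem_univ a)
      exact lt_of_le_of_ne (not_lt.1 this) (π.injective.ne (Fin.castSucc_lt_last a).ne)
    · obtain ⟨y, hy, hmin⟩ := Finset.exists_min_image _
        (fun a : Fin j => σ ⟨n - j + a, by omega⟩) hU
      simp only [Finset.mem_filter, Finset.mem_univ, true_and] at hy hmin
      have hiff : ∀ a : Fin j, σ ⟨n - j + a, by omega⟩ < σ ⟨n - j + y, by omega⟩ ↔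
          π a.castSucc < π (Fin.last j) := by
        intro a
        rw [← hlt]
        constructor
        · intro ha
          by_contra hc
          have hc' := lt_of_le_of_ne (not_lt.1 hc) (π.injective.ne (Fin.castSucc_lt_last a).ne')
          have := hmin a hc'
          rw [hlt] at ha
          exact absurd ha (not_lt.2 this)
        · exact fun ha => ha.trans hy
      refine ⟨σ ⟨n - j + y, by omega⟩, hiff, fun a b hab hb ha => ?_⟩
      have hb : σ b < σ ⟨n - j + y, by omega⟩ := hb
      have ha : σ ⟨n - j + y, by omega⟩ ≤ σ a := ha
      -- Suppose `a`, `b` and the new entry form 312. If `b` precedes `y`, then `a`, `b`, `y` form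
      -- 312 in `σ`; if `b` follows `y`, then `y`, `b` and the last entry form 312 in `π`.
      rcases lt_trichotomy b ⟨n - j + y, by omega⟩ with hby | hby | hby
      · exact hσ a b _ hab hby hb (lt_of_le_of_ne ha (σ.injective.ne (hab.trans hby).ne'))
      · exact (hby ▸ hb).false
      · have hby' : n - j + (y : ℕ) < b := hby
        obtain ⟨b₀, hb₀⟩ : ∃ b₀ : Fin j, b = ⟨n - j + b₀, by omega⟩ :=
          ⟨⟨b - (n - j), by omega⟩, by ext; simp; omega⟩
        rw [hb₀] at hb hby'
        refine hπ y.castSucc b₀.castSucc (Fin.last j) ?_ (Fin.castSucc_lt_last _)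
          ((hiff _).1 hb) hy
        rw [Fin.castSucc_lt_castSucc_iff, Fin.lt_def]
        simp only at hby'
        omega
  -- Old values become odd and the new one even, so the new entry falls strictly between the values
  -- `t - 1` and `t` of `σ`.
  let x : Fin (n + 1) → ℕ := Fin.lastCases (2 * t) fun i => 2 * (σ i : ℕ) + 1
  have hx₁ : ∀ i : Fin n, x i.castSucc = 2 * (σ i : ℕ) + 1 := fun i => by simp [x]
  have hx₂ : x (Fin.last n) = 2 * t := by simp [x]
  have hx : Function.Injective x := by
    intro a b
    induction a using Fin.lastCases <;> induction b using Fin.lastCases <;>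
      simp only [hx₁, hx₂] <;> intro hab
    · trivial
    · omega
    · omega
    · congr 1
      exact σ.injective (Fin.ext (by omega))
  refine ⟨std x, avoids_312_std hx ?_, ?_, ?_⟩
  · intro a b c hab hbc h₁ h₂
    obtain ⟨b, rfl⟩ := Fin.exists_castSucc_eq.2 (hbc.trans_le (Fin.le_last c)).ne
    obtain ⟨a, rfl⟩ := Fin.exists_castSucc_eq.2 (hab.trans_le (Fin.le_last _)).ne
    rw [Fin.castSucc_lt_castSucc_iff] at hab
    induction c using Fin.lastCases with
    | last =>
      rw [hx₁, hx₂] at *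
      exact ht₂ a b hab (by omega) (by omega)
    | cast c =>
      rw [hx₁, hx₁] at *
      exact hσ a b c hab hbc (Fin.lt_def.2 (by omega)) (Fin.lt_def.2 (by omega))
  · rw [eq_pat_iff]
    intro a b
    have hc : ∀ a : Fin n, intervalEmb 0 (by omega : 0 + n ≤ n + 1) a = a.castSucc := fun a => by
      ext; simp [val_intervalEmb]
    rw [std_lt_std_iff hx, hc, hc, hx₁, hx₁, Fin.lt_def]
    omega
  · rw [eq_pat_iff]
    have hc : ∀ a : Fin j, intervalEmb (n - j) (by omega : n - j + (j + 1) ≤ n + 1) a.castSucc =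
        (⟨n - j + a, by omega⟩ : Fin n).castSucc := fun a => by
      ext; simp [val_intervalEmb]
    have hl : intervalEmb (n - j) (by omega : n - j + (j + 1) ≤ n + 1) (Fin.last j) =
        Fin.last n := by
      ext; simp [val_intervalEmb]; omega
    intro a b
    rw [std_lt_std_iff hx]
    induction a using Fin.lastCases with
    | last =>
      induction b using Fin.lastCases with
      | last => simp
      | cast b =>
        rw [hl, hc, hx₁, hx₂]
        have hne : π b.castSucc ≠ π (Fin.last j) := π.injective.ne (Fin.castSucc_lt_last b).ne
        have := ht₁ b
        have h' : π (Fin.last j) < π b.castSucc ↔ ¬ π b.castSucc < π (Fin.last j) := by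
          rw [not_lt]; exact ⟨le_of_lt, fun h => lt_of_le_of_ne h hne.symm⟩
        rw [h', ← this]
        omega
    | cast a =>
      induction b using Fin.lastCases with
      | last =>
        rw [hl, hc, hx₁, hx₂, ← ht₁ a]
        omega
      | cast b =>
        rw [hc, hc, hx₁, hx₁, hlt, Fin.lt_def]
        omega

/-! ### Permutations as walks in the overlap graph -/

/-- The list `w` consists of the successive patterns of size `j + 1` of `σ`. -/
def HasWindows {n j : ℕ} {B : Set FinPerm} (σ : Equiv.Perm (Fin n)) (w : List (AvSize B (j + 1))) :
    Prop :=
  n = w.length + j ∧ ∀ s (h : s + (j + 1) ≤ n) (h' : s < w.length),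
    pat (intervalEmb s h) σ = w[s].1

theorem HasWindows.consecutiveOcc_eq {n j : ℕ} {B : Set FinPerm} {σ : Equiv.Perm (Fin n)}
    {w : List (AvSize B (j + 1))} (h : HasWindows σ w) (π : AvSize B (j + 1)) :
    (consecutiveOcc π.1 σ : ℝ) = DirMultigraph.multiplicity w π := by
  rw [DirMultigraph.multiplicity, Nat.cast_inj]
  have hset : {s : ℕ | ∃ h : s + (j + 1) ≤ n, pat (intervalEmb s h) σ = π.1} =
      {s : ℕ | w[s]? = some π} := by
    ext s
    simp only [Set.mem_ofPred_eq, List.getElem?_eq_some_iff]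
    have hn := h.1
    constructor
    · rintro ⟨hs, hp⟩
      have hs' : s < w.length := by omega
      exact ⟨hs', Subtype.ext ((h.2 s hs hs').symm.trans hp)⟩
    · rintro ⟨hs, rfl⟩
      exact ⟨by omega, h.2 s (by omega) hs⟩
  rw [consecutiveOcc, hset]
  clear hset h
  induction w using List.reverseRecOn with
  | nil => simp
  | append_singleton w e ih =>
    have hfin : {s : ℕ | w[s]? = some π}.Finite :=
      (Set.finite_lt_nat w.length).subset fun s hs => by
        obtain ⟨h, -⟩ := List.getElem?_eq_some_iff.1 hs
        exact h
    by_cases he : e = π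
    · have : {s : ℕ | (w ++ [e])[s]? = some π} = insert w.length {s : ℕ | w[s]? = some π} := by
        ext s
        simp only [Set.mem_ofPred_eq, Set.mem_insert_iff, List.getElem?_append]
        split_ifs with hs
        · simp [hs.ne]
        · rcases eq_or_ne s w.length with rfl | hne
          · simp [he]
          · have h1 : s - w.length ≠ 0 := by omega
            have h2 : w.length ≤ s := by omega
            simp [hne, h1, h2]
      have hnot : w.length ∉ {s : ℕ | w[s]? = some π} := by simp
      rw [this, Set.ncard_insert_of_notMem hnot hfin, ih]
      simp [he]
    · have : {s : ℕ | (w ++ [e])[s]? = some π} = {s : ℕ | w[s]? = some π} := by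
        ext s
        simp only [Set.mem_ofPred_eq, List.getElem?_append]
        split_ifs with hs
        · rfl
        · have h2 : w.length ≤ s := by omega
          rcases eq_or_ne (s - w.length) 0 with h0 | h0
          · simp [h0, he, h2]
          · simp [h0, h2]
      rw [this, ih]
      simp [he]

/-- The successive patterns of a permutation form a walk in the overlap graph. -/
theorem exists_hasWindows {n j : ℕ} {B : Set FinPerm} (hj : j ≤ n) {σ : Equiv.Perm (Fin n)}
    (hσ : Avoids B σ) :
    ∃ w : List (AvSize B (j + 1)), HasWindows σ w ∧ (overlapGraph B (j + 1)).IsWalkBetween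
      (⟨pat (intervalEmb 0 (by omega : 0 + j ≤ n)) σ, hσ.pat _⟩ : AvSize B j) w
      (⟨pat (intervalEmb (n - j) (by omega : n - j + j ≤ n)) σ, hσ.pat _⟩ : AvSize B j) := by
  have key : ∀ m (hm : m + j ≤ n), ∃ w : List (AvSize B (j + 1)), w.length = m ∧
      (∀ s (h : s + (j + 1) ≤ n) (h' : s < w.length), pat (intervalEmb s h) σ = w[s].1) ∧
      (overlapGraph B (j + 1)).IsWalkBetween
        (⟨pat (intervalEmb 0 (by omega : 0 + j ≤ n)) σ, hσ.pat _⟩ : AvSize B j) w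
        (⟨pat (intervalEmb m hm) σ, hσ.pat _⟩ : AvSize B j) := by
    intro m
    induction m with
    | zero => exact fun _ => ⟨[], rfl, by simp, rfl⟩
    | succ m ih =>
      intro hm
      obtain ⟨w, hw, hws, hwalk⟩ := ih (by omega)
      refine ⟨w ++ [⟨pat (intervalEmb m (by omega : m + (j + 1) ≤ n)) σ, hσ.pat _⟩],
        by simp [hw], ?_, hwalk.append ⟨Subtype.ext ?_, Subtype.ext ?_⟩⟩
      · intro s h h'
        rw [List.length_append, List.length_singleton] at h'
        rcases Nat.lt_succ_iff_lt_or_eq.1 h' with hs | rfl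
        · rw [List.getElem_append_left hs]
          exact hws s h hs
        · simp [hw]
      · simp only [overlapGraph, beginPat]
        exact pat_intervalEmb_pat _ _ _
      · simp only [overlapGraph, endPat, Nat.add_sub_cancel]
        refine (pat_intervalEmb_pat _ _ _).trans ?_
        congr 2
        omega
  obtain ⟨w, hw, hws, hwalk⟩ := key (n - j) (by omega)
  exact ⟨w, ⟨by omega, hws⟩, hwalk⟩

/-- Every walk in the overlap graph of `Av(312)` is the sequence of successive patterns of a
`312`-avoiding permutation. -/
theorem exists_perm_of_walk {j : ℕ} {w : List (AvSize B312 (j + 1))} {a b : AvSize B312 j}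
    (hw : (overlapGraph B312 (j + 1)).IsWalkBetween a w b) :
    ∃ σ : Equiv.Perm (Fin (w.length + j)), Avoids B312 σ ∧ HasWindows σ w := by
  -- The induction also needs the last `j` entries of `σ` to form the endpoint of the walk, as this
  -- is the compatibility required by `exists_extension`.
  suffices h : ∀ n, n = w.length + j → ∃ σ : Equiv.Perm (Fin n), Avoids B312 σ ∧ HasWindows σ w ∧
      ∀ h : n - j + j ≤ n, pat (intervalEmb (n - j) h) σ = b.1 by
    obtain ⟨σ, h₁, h₂, -⟩ := h _ rfl
    exact ⟨σ, h₁, h₂⟩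
  induction w using List.reverseRecOn generalizing b with
  | nil =>
    cases hw
    rintro n hn
    obtain rfl : n = j := by simpa using hn
    refine ⟨a.1, a.2, ⟨by simp, by simp⟩, fun h => ?_⟩
    rw [eq_pat_iff]
    intro i l
    have hc : ∀ i, intervalEmb (n - n) h i = i := fun i => by ext; simp [val_intervalEmb]
    rw [hc, hc]
  | append_singleton w e ih =>
    obtain ⟨c, hwc, hce, heb⟩ := hw.exists_of_append
    rintro n hn
    obtain ⟨m, rfl⟩ : ∃ m, n = m + 1 := ⟨w.length + j, by rw [hn]; simp; omega⟩
    have hm : m = w.length + j := by simp at hn; omega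
    obtain ⟨σ, hσ, hwin, hend⟩ := ih hwc m hm
    have hjm : j ≤ m := by omega
    have hcomp : pat (intervalEmb 0 (by omega : 0 + j ≤ j + 1)) e.1 =
        pat (intervalEmb (m - j) (by omega : m - j + j ≤ m)) σ := by
      rw [hend]
      exact congrArg Subtype.val hce
    obtain ⟨σ', hσ', hbeg, hlast⟩ := exists_extension hjm hσ e.2 hcomp
    refine ⟨σ', hσ', ⟨by simp; omega, ?_⟩, fun h => ?_⟩
    · intro s h h'
      rw [List.length_append, List.length_singleton] at h'
      rcases Nat.lt_succ_iff_lt_or_eq.1 h' with hs | hs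
      · rw [List.getElem_append_left hs, ← hwin.2 s (by omega) hs, ← hbeg, pat_intervalEmb_pat]
        congr 2
        omega
      · subst hs
        simp only [List.getElem_concat_length]
        rw [← hlast]
        congr 2
        omega
    · have hb : endPat j (Nat.sub_le (j + 1) 1) e.1 = b.1 := congrArg Subtype.val heb
      rw [← hb, endPat, ← hlast, pat_intervalEmb_pat]
      congr 2
      omega

/-- The overlap graph of `Av(312)` is strongly connected. -/
theorem exists_isWalkBetween_overlapGraph {j : ℕ} (a b : AvSize B312 j) :
    ∃ w, (overlapGraph B312 (j + 1)).IsWalkBetween a w b := by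
  obtain ⟨a, ha⟩ := a
  obtain ⟨b, hb⟩ := b
  -- The direct sum of `a` and `b`, whose windows lead from `a` to `b`. It avoids 312 because an
  -- occurrence cannot straddle the two blocks.
  let x : Fin (j + j) → ℕ := Fin.addCases (fun i => (a i : ℕ)) fun i => j + (b i : ℕ)
  have hx₁ : ∀ i, x (Fin.castAdd j i) = a i := fun i => by simp [x]
  have hx₂ : ∀ i, x (Fin.natAdd j i) = j + b i := fun i => Fin.addCases_right i
  have hx : Function.Injective x := by
    intro p q
    induction p using Fin.addCases <;> induction q using Fin.addCases <;>
      simp only [hx₁, hx₂] <;> intro h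
    · congr 1
      exact a.injective (Fin.ext h)
    · omega
    · omega
    · congr 1
      exact b.injective (Fin.ext (by omega))
  have hσ : Avoids B312 (std x) := by
    rw [avoids_312_iff] at ha hb
    refine avoids_312_std hx fun p q r hpq hqr h₁ h₂ => ?_
    induction p using Fin.addCases <;> induction q using Fin.addCases <;>
      induction r using Fin.addCases <;> simp only [hx₁, hx₂] at h₁ h₂ <;>
      simp only [Fin.lt_def, Fin.val_castAdd, Fin.val_natAdd] at hpq hqr <;> try omega
    · exact ha _ _ _ hpq hqr (Fin.lt_def.2 h₁) (Fin.lt_def.2 h₂)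
    · exact hb _ _ _ (Fin.lt_def.2 (by omega)) (Fin.lt_def.2 (by omega))
        (Fin.lt_def.2 (Nat.lt_of_add_lt_add_left h₁)) (Fin.lt_def.2 (Nat.lt_of_add_lt_add_left h₂))
  obtain ⟨w, -, hw⟩ := exists_hasWindows (Nat.le_add_left j j) hσ
  refine ⟨w, ?_⟩
  convert hw using 1
  · refine Subtype.ext (Eq.symm ?_)
    rw [eq_pat_iff]
    intro p q
    have hc : ∀ p, intervalEmb 0 (by omega : 0 + j ≤ j + j) p = Fin.castAdd j p := fun p => by
      ext; simp [val_intervalEmb]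
    rw [std_lt_std_iff hx, hc, hc, hx₁, hx₁, Fin.lt_def]
  · refine Subtype.ext (Eq.symm ?_)
    rw [eq_pat_iff]
    intro p q
    have hc : ∀ p, intervalEmb (j + j - j) (by omega : j + j - j + j ≤ j + j) p =
        Fin.natAdd j p := fun p => by
      ext; rw [val_intervalEmb, Fin.val_natAdd]; omega
    rw [std_lt_std_iff hx, hc, hc, hx₂, hx₂, Fin.lt_def]
    exact (Nat.add_lt_add_iff_left).symm

/-! ### Catalan enumeration by the last value -/

/-- In a `312`-avoiding permutation, the entries smaller than the last one come first. -/
theorem lt_last_iff_of_avoids {n : ℕ} {σ : Equiv.Perm (Fin (n + 1))} (hσ : Avoids B312 σ)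
    (i : Fin (n + 1)) : σ i < σ (Fin.last n) ↔ i < σ (Fin.last n) := by
  rw [avoids_312_iff] at hσ
  -- Otherwise `a`, `b` and the last position form 312. So the positions of the smaller values form
  -- an initial segment, whose length is found by counting.
  have hdown : ∀ a b, a < b → σ b < σ (Fin.last n) → σ a < σ (Fin.last n) := by
    intro a b hab hb
    by_contra ha
    have hbl : b < Fin.last n := Fin.lt_last_iff_ne_last.2 (by rintro rfl; exact hb.false)
    exact hσ a b _ hab hbl hb
      (lt_of_le_of_ne (not_lt.1 ha) (σ.injective.ne (hab.trans hbl).ne'))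
  constructor
  · intro hi
    have hsub : (Finset.Iic i).image σ ⊆ Finset.Iio (σ (Fin.last n)) := by
      intro y hy
      obtain ⟨a, ha, rfl⟩ := Finset.mem_image.1 hy
      rw [Finset.mem_Iio]
      rcases (Finset.mem_Iic.1 ha).lt_or_eq with h | rfl
      · exact hdown a i h hi
      · exact hi
    have := Finset.card_le_card hsub
    rw [Finset.card_image_of_injective _ σ.injective, Fin.card_Iic, Fin.card_Iio] at this
    exact Fin.lt_def.2 (by omega)
  · intro hi
    by_contra hc
    have hsub : (Finset.Iio (σ (Fin.last n))).image σ.symm ⊆ Finset.Iio i := by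
      intro y hy
      obtain ⟨a, ha, rfl⟩ := Finset.mem_image.1 hy
      rw [Finset.mem_Iio] at ha ⊢
      by_contra hia
      have ha' : σ (σ.symm a) < σ (Fin.last n) := by simpa using ha
      rcases (not_lt.1 hia).lt_or_eq with h | h
      · exact hc (hdown _ _ h ha')
      · exact hc (h ▸ ha')
    have := Finset.card_le_card hsub
    rw [Finset.card_image_of_injective _ σ.symm.injective, Fin.card_Iio, Fin.card_Iio] at this
    exact absurd (Fin.lt_def.1 hi) (by omega)

theorem intervalEmb_zero_eq {p m : ℕ} (i : Fin p) :
    intervalEmb 0 (by omega : 0 + p ≤ p + m + 1) i = (Fin.castAdd m i).castSucc := by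
  ext; simp [val_intervalEmb]

theorem intervalEmb_natAdd_eq {p m : ℕ} (i : Fin m) :
    intervalEmb p (by omega : p + m ≤ p + m + 1) i = (Fin.natAdd p i).castSucc := by
  ext; simp [val_intervalEmb]

/-- The `312`-avoiding permutation with last value `p`, whose entries below and above `p` form
given `312`-avoiding permutations. -/
theorem exists_glue {p m : ℕ} {L : Equiv.Perm (Fin p)} {U : Equiv.Perm (Fin m)}
    (hL : Avoids B312 L) (hU : Avoids B312 U) :
    ∃ σ : Equiv.Perm (Fin (p + m + 1)), Avoids B312 σ ∧ (σ (Fin.last (p + m)) : ℕ) = p ∧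
      pat (intervalEmb 0 (by omega : 0 + p ≤ p + m + 1)) σ = L ∧
      pat (intervalEmb p (by omega : p + m ≤ p + m + 1)) σ = U := by
  -- One-line notation: `L`, then `U` raised by `p + 1`, then `p`.
  let x : Fin (p + m + 1) → Fin (p + m + 1) := Fin.lastCases ⟨p, by omega⟩
    (Fin.addCases (fun i => ⟨L i, by omega⟩) fun i => ⟨p + 1 + U i, by omega⟩)
  have hx₁ : ∀ i, (x (Fin.castAdd m i).castSucc : ℕ) = L i := fun i => by simp [x]
  have hx₂ : ∀ i, (x (Fin.natAdd p i).castSucc : ℕ) = p + 1 + U i := fun i => by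
    simp only [x, Fin.lastCases_castSucc, Fin.addCases_right]
  have hx₃ : (x (Fin.last (p + m)) : ℕ) = p := by simp [x]
  have hx : Function.Injective x := by
    intro a b hab
    have hab := congrArg Fin.val hab
    induction a using Fin.lastCases with
    | last =>
      induction b using Fin.lastCases with
      | last => rfl
      | cast b => induction b using Fin.addCases <;> simp only [hx₁, hx₂, hx₃] at hab <;> omega
    | cast a =>
      induction b using Fin.lastCases with
      | last => induction a using Fin.addCases <;> simp only [hx₁, hx₂, hx₃] at hab <;> omega
      | cast b =>
        induction a using Fin.addCases <;> induction b using Fin.addCases <;>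
          simp only [hx₁, hx₂] at hab <;> try omega
        · congr 2
          exact L.injective (Fin.ext hab)
        · congr 2
          exact U.injective (Fin.ext (by omega))
  let σ : Equiv.Perm (Fin (p + m + 1)) :=
    Equiv.ofBijective x (Finite.injective_iff_bijective.1 hx)
  have hσ : ∀ i, σ i = x i := fun i => rfl
  refine ⟨σ, avoids_312_iff.2 ?_, hx₃, ?_, ?_⟩
  · intro a b c hab hbc h₁ h₂
    rw [avoids_312_iff] at hL hU
    obtain ⟨b, rfl⟩ := Fin.exists_castSucc_eq.2 (hbc.trans_le (Fin.le_last c)).ne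
    obtain ⟨a, rfl⟩ := Fin.exists_castSucc_eq.2 (hab.trans_le (Fin.le_last _)).ne
    rw [Fin.lt_def, hσ, hσ] at h₁ h₂
    rw [Fin.lt_def] at hab hbc
    induction c using Fin.lastCases with
    | last =>
      induction a using Fin.addCases <;> induction b using Fin.addCases <;>
        simp only [hx₁, hx₂, hx₃, Fin.val_castSucc, Fin.val_castAdd, Fin.val_natAdd]
          at h₁ h₂ hab <;> omega
    | cast c =>
      induction a using Fin.addCases <;> induction b using Fin.addCases <;>
        induction c using Fin.addCases <;>
        simp only [hx₁, hx₂, Fin.val_castSucc, Fin.val_castAdd, Fin.val_natAdd]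
          at h₁ h₂ hab hbc <;> try omega
      · exact hL _ _ _ hab hbc (Fin.lt_def.2 h₁) (Fin.lt_def.2 h₂)
      · exact hU _ _ _ (Fin.lt_def.2 (by omega)) (Fin.lt_def.2 (by omega))
          (Fin.lt_def.2 (Nat.lt_of_add_lt_add_left h₁)) (Fin.lt_def.2 (Nat.lt_of_add_lt_add_left h₂))
  · rw [eq_pat_iff]
    intro i l
    rw [intervalEmb_zero_eq, intervalEmb_zero_eq, hσ, hσ, Fin.lt_def, Fin.lt_def, hx₁, hx₁]
  · rw [eq_pat_iff]
    intro i l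
    rw [intervalEmb_natAdd_eq, intervalEmb_natAdd_eq, hσ, hσ, Fin.lt_def, Fin.lt_def, hx₂, hx₂]
    omega

/-- By `lt_last_iff_of_avoids`, the first `p` entries lie below the last value `p` and the next `m`
above it. Comparisons between blocks are thus forced, and those inside a block are given by the two
patterns. -/
theorem eq_of_pat_eq_of_last_eq {p m : ℕ} {σ τ : Equiv.Perm (Fin (p + m + 1))}
    (hσ : Avoids B312 σ) (hτ : Avoids B312 τ) (hσp : (σ (Fin.last (p + m)) : ℕ) = p)
    (hτp : (τ (Fin.last (p + m)) : ℕ) = p)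
    (h₁ : pat (intervalEmb 0 (by omega : 0 + p ≤ p + m + 1)) σ =
      pat (intervalEmb 0 (by omega : 0 + p ≤ p + m + 1)) τ)
    (h₂ : pat (intervalEmb p (by omega : p + m ≤ p + m + 1)) σ =
      pat (intervalEmb p (by omega : p + m ≤ p + m + 1)) τ) : σ = τ := by
  have hlow : ∀ {ρ : Equiv.Perm (Fin (p + m + 1))}, Avoids B312 ρ →
      (ρ (Fin.last (p + m)) : ℕ) = p → ∀ i : Fin p, (ρ (Fin.castAdd m i).castSucc : ℕ) < p := by
    intro ρ hρ hp i
    have h := (lt_last_iff_of_avoids hρ (Fin.castAdd m i).castSucc).2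
      (Fin.lt_def.2 (by rw [hp]; simp))
    rwa [Fin.lt_def, hp] at h
  have hhigh : ∀ {ρ : Equiv.Perm (Fin (p + m + 1))}, Avoids B312 ρ →
      (ρ (Fin.last (p + m)) : ℕ) = p → ∀ i : Fin m, p < (ρ (Fin.natAdd p i).castSucc : ℕ) := by
    intro ρ hρ hp i
    have h := (lt_last_iff_of_avoids hρ (Fin.natAdd p i).castSucc).not.2
      (by rw [Fin.lt_def, hp]; simp)
    rw [Fin.lt_def, hp] at h
    have hne : (ρ (Fin.natAdd p i).castSucc : ℕ) ≠ ρ (Fin.last (p + m)) :=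
      fun h => (Fin.castSucc_lt_last _).ne (ρ.injective (Fin.ext h))
    omega
  refine eq_of_lt_iff_lt fun a b => ?_
  have e₁ : ∀ i l : Fin p, σ (Fin.castAdd m i).castSucc < σ (Fin.castAdd m l).castSucc ↔
      τ (Fin.castAdd m i).castSucc < τ (Fin.castAdd m l).castSucc := by
    intro i l
    have h := (eq_pat_iff _ _ _).1 h₁ i l
    rw [pat_lt_pat_iff] at h
    simpa only [intervalEmb_zero_eq] using h.symm
  have e₂ : ∀ i l : Fin m, σ (Fin.natAdd p i).castSucc < σ (Fin.natAdd p l).castSucc ↔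
      τ (Fin.natAdd p i).castSucc < τ (Fin.natAdd p l).castSucc := by
    intro i l
    have h := (eq_pat_iff _ _ _).1 h₂ i l
    rw [pat_lt_pat_iff] at h
    simpa only [intervalEmb_natAdd_eq] using h.symm
  have l₁ := hlow hσ hσp
  have l₂ := hlow hτ hτp
  have u₁ := hhigh hσ hσp
  have u₂ := hhigh hτ hτp
  induction a using Fin.lastCases with
  | last =>
    induction b using Fin.lastCases with
    | last => simp
    | cast b =>
      induction b using Fin.addCases with
      | left b =>
        have := l₁ b; have := l₂ b
        rw [Fin.lt_def, Fin.lt_def]; omega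
      | right b =>
        have := u₁ b; have := u₂ b
        rw [Fin.lt_def, Fin.lt_def]; omega
  | cast a =>
    induction a using Fin.addCases with
    | left a =>
      have := l₁ a; have := l₂ a
      induction b using Fin.lastCases with
      | last => rw [Fin.lt_def, Fin.lt_def]; omega
      | cast b =>
        induction b using Fin.addCases with
        | left b => exact e₁ a b
        | right b =>
          have := u₁ b; have := u₂ b
          rw [Fin.lt_def, Fin.lt_def]; omega
    | right a =>
      have := u₁ a; have := u₂ a
      induction b using Fin.lastCases with
      | last => rw [Fin.lt_def, Fin.lt_def]; omega
      | cast b =>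
        induction b using Fin.addCases with
        | left b =>
          have := l₁ b; have := l₂ b
          rw [Fin.lt_def, Fin.lt_def]; omega
        | right b => exact e₂ a b

/-- Cutting at position `p` is a bijection, inverted by `exists_glue`; this yields the Catalan
recursion. -/
theorem card_avoids_312_last_eq (p m : ℕ) :
    Nat.card {σ : AvSize B312 (p + m + 1) // (σ.1 (Fin.last (p + m)) : ℕ) = p} =
      Nat.card (AvSize B312 p) * Nat.card (AvSize B312 m) := by
  rw [← Nat.card_prod]
  refine Nat.card_congr (Equiv.ofBijective (fun σ =>
    (⟨pat (intervalEmb 0 (by omega : 0 + p ≤ p + m + 1)) σ.1.1, σ.1.2.pat _⟩,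
      ⟨pat (intervalEmb p (by omega : p + m ≤ p + m + 1)) σ.1.1, σ.1.2.pat _⟩)) ⟨?_, ?_⟩)
  · intro σ τ h
    have h₁ := congrArg (fun q => q.1.1) h
    have h₂ := congrArg (fun q => q.2.1) h
    exact Subtype.ext (Subtype.ext (eq_of_pat_eq_of_last_eq σ.1.2 τ.1.2 σ.2 τ.2 h₁ h₂))
  · rintro ⟨⟨L, hL⟩, ⟨U, hU⟩⟩
    obtain ⟨σ, hσ, hp, h₁, h₂⟩ := exists_glue hL hU
    exact ⟨⟨⟨σ, hσ⟩, hp⟩, Prod.ext (Subtype.ext h₁) (Subtype.ext h₂)⟩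

/-- The permutations that avoid `312` are counted by the Catalan numbers. -/
theorem card_avoids_312 (n : ℕ) : Nat.card (AvSize B312 n) = catalan n := by
  induction n using Nat.strong_induction_on with
  | _ n ih =>
  cases n with
  | zero =>
    rw [catalan_zero, Nat.card_eq_one_iff_unique]
    exact ⟨inferInstance, ⟨⟨1, avoids_312_iff.2 fun a => a.elim0⟩⟩⟩
  | succ n =>
    rw [catalan_succ, ← Nat.card_congr (Equiv.sigmaFiberEquiv
      fun σ : AvSize B312 (n + 1) => σ.1 (Fin.last n)), Nat.card_sigma]
    refine Finset.sum_congr rfl fun i _ => ?_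
    rw [← ih i (by omega), ← ih (n - i) (by omega), ← card_avoids_312_last_eq]
    have hn : (i : ℕ) + (n - i) = n := by omega
    obtain ⟨i, hi⟩ := i
    simp only at hn ⊢
    generalize n - i = m at hn
    subst hn
    exact Nat.card_congr (Equiv.subtypeEquivRight fun σ => Fin.ext_iff)

/-! ### The feasible region and the cycle polytope -/

/-- `extendZero` as a linear map. -/
noncomputable def extendZeroLinear (B : Set FinPerm) (k : ℕ) :
    (AvSize B k → ℝ) →ₗ[ℝ] (Equiv.Perm (Fin k) → ℝ) :=
  Function.ExtendByZero.linearMap ℝ Subtype.val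

theorem extendZeroLinear_apply (B : Set FinPerm) (k : ℕ) (v : AvSize B k → ℝ) :
    extendZeroLinear B k v = extendZero B k v := rfl

theorem extendZero_apply {B : Set FinPerm} {k : ℕ} (v : AvSize B k → ℝ) (π : AvSize B k) :
    extendZero B k v π.1 = v π :=
  Subtype.val_injective.extend_apply v 0 π

theorem extendZero_of_not_avoids {B : Set FinPerm} {k : ℕ} (v : AvSize B k → ℝ)
    {π : Equiv.Perm (Fin k)} (hπ : ¬ Avoids B π) : extendZero B k v π = 0 :=
  Function.extend_apply' _ _ _ fun ⟨ρ, h⟩ => hπ (h ▸ ρ.2)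

theorem extendZeroLinear_injective (B : Set FinPerm) (k : ℕ) :
    Function.Injective (extendZeroLinear B k) := fun v w h =>
  funext fun π => by
    have := congrFun h π.1
    rwa [extendZeroLinear_apply, extendZeroLinear_apply, extendZero_apply, extendZero_apply]
      at this

theorem consecutiveProp_of_not_avoids {B : Set FinPerm} {k n : ℕ} {π : Equiv.Perm (Fin k)}
    {σ : Equiv.Perm (Fin n)} (hσ : Avoids B σ) (hπ : ¬ Avoids B π) : consecutiveProp π σ = 0 := by
  have : {s : ℕ | ∃ h : s + k ≤ n, pat (intervalEmb s h) σ = π} = ∅ := by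
    rw [Set.eq_empty_iff_forall_notMem]
    rintro s ⟨h, rfl⟩
    exact hπ (hσ.pat _)
  simp [consecutiveProp, consecutiveOcc, this]

/-- A limit of proportions of consecutive patterns is a unit circulation of the overlap
graph. -/
theorem mem_unitCirculations_of_tendsto {B : Set FinPerm} {j : ℕ} [Fintype (AvSize B (j + 1))]
    {v : AvSize B (j + 1) → ℝ} (hv : ∀ π, 0 ≤ v π) {σ : ℕ → FinPerm} (hσ : ∀ m, σ m ∈ Av B)
    (hsize : Tendsto (fun m => (σ m).1) atTop atTop)
    (hlim : ∀ π, Tendsto (fun m => consecutiveProp π.1 (σ m).2) atTop (𝓝 (v π))) :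
    v ∈ (overlapGraph B (j + 1)).unitCirculations := by
  have hsize' : Tendsto (fun m => ((σ m).1 : ℝ)) atTop atTop :=
    tendsto_natCast_atTop_atTop.comp hsize
  let x : ℕ → AvSize B (j + 1) → ℝ := fun m π => consecutiveProp π.1 (σ m).2
  have hx : ∀ m, j ≤ (σ m).1 → ∃ (w : List (AvSize B (j + 1))) (a b : AvSize B j),
      (overlapGraph B (j + 1)).IsWalkBetween a w b ∧ (σ m).1 = w.length + j ∧
      x m = ((σ m).1 : ℝ)⁻¹ • DirMultigraph.multiplicity w := by
    intro m hm
    obtain ⟨w, hw, hwalk⟩ := exists_hasWindows hm (hσ m).2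
    refine ⟨w, _, _, hwalk, hw.1, funext fun π => ?_⟩
    simp only [x, consecutiveProp, hw.consecutiveOcc_eq]
    simp [div_eq_inv_mul]
  have hxlim : Tendsto x atTop (𝓝 v) := tendsto_pi_nhds.2 hlim
  have hev : ∀ᶠ m in atTop, j ≤ (σ m).1 := hsize.eventually_ge_atTop j
  refine ⟨hv, funext fun u => ?_, ?_⟩
  · have h₁ : Tendsto (fun m => (overlapGraph B (j + 1)).boundary (x m) u) atTop
        (𝓝 ((overlapGraph B (j + 1)).boundary v u)) :=
      ((continuous_apply u).comp
        (LinearMap.continuous_of_finiteDimensional _)).continuousAt.tendsto.comp hxlim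
    -- The boundary of a walk has entries of absolute value at most 1, which vanish after division
    -- by the size.
    have h₂ : Tendsto (fun m => (overlapGraph B (j + 1)).boundary (x m) u) atTop (𝓝 0) := by
      refine squeeze_zero_norm' ?_ hsize'.inv_tendsto_atTop
      filter_upwards [hev] with m hm
      obtain ⟨w, a, b, hw, -, hxm⟩ := hx m hm
      rw [hxm, map_smul, hw.boundary_multiplicity, Pi.smul_apply, smul_eq_mul, norm_mul,
        Real.norm_of_nonneg (by positivity)]
      refine mul_le_of_le_one_right (by positivity) ?_
      simp only [Pi.sub_apply, Pi.single_apply]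
      split_ifs <;> simp
    exact tendsto_nhds_unique h₁ h₂
  · have h₁ : Tendsto (fun m => ∑ π, x m π) atTop (𝓝 (∑ π, v π)) :=
      tendsto_finsetSum _ fun π _ => hlim π
    -- A permutation of size `n ≥ j` has `n - j` windows, so the mass is `1 - j / n`.
    have h₂ : Tendsto (fun m => ∑ π, x m π) atTop (𝓝 1) := by
      have h : Tendsto (fun m => 1 - (j : ℝ) / (σ m).1) atTop (𝓝 (1 - 0)) :=
        tendsto_const_nhds.sub (hsize'.const_div_atTop _)
      rw [sub_zero] at h
      refine h.congr' ?_
      filter_upwards [hev] with m hm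
      obtain ⟨w, a, b, -, hl, hxm⟩ := hx m hm
      have hpos : ((σ m).1 : ℝ) ≠ 0 := by have := (hσ m).1; positivity
      rw [hxm]
      simp only [Pi.smul_apply, smul_eq_mul, ← Finset.mul_sum, DirMultigraph.sum_multiplicity]
      have hl' : ((σ m).1 : ℝ) = w.length + j := by exact_mod_cast hl
      field_simp
      linarith
    exact tendsto_nhds_unique h₁ h₂

/-- Every point of the cycle polytope of the overlap graph of `Av(312)` is feasible. -/
theorem exists_tendsto_of_mem_cyclePolytope {j : ℕ} [Fintype (AvSize B312 (j + 1))]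
    {v : AvSize B312 (j + 1) → ℝ} (hv : v ∈ cyclePolytope (overlapGraph B312 (j + 1))) :
    ∃ σ : ℕ → FinPerm, (∀ m, σ m ∈ Av B312) ∧ Tendsto (fun m => (σ m).1) atTop atTop ∧
      ∀ π : AvSize B312 (j + 1),
        Tendsto (fun m => consecutiveProp π.1 (σ m).2) atTop (𝓝 (v π)) := by
  have hone : Avoids B312 (1 : Equiv.Perm (Fin j)) :=
    avoids_312_iff.2 fun a b c hab hbc _ h => (h.trans (hab.trans hbc)).false
  obtain ⟨K, hK⟩ := DirMultigraph.exists_walk_approx exists_isWalkBetween_overlapGraph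
    (⟨1, hone⟩ : AvSize B312 j) hv
  have hsum : ∑ π, v π = 1 := by
    rw [DirMultigraph.cyclePolytope_eq] at hv
    exact hv.2.2
  choose W hW hWK using hK
  choose τ hτ hτW using fun N => exists_perm_of_walk (hW N)
  set M : ℝ := Fintype.card (AvSize B312 (j + 1)) * K
  have hlen : ∀ N, |((W N).length : ℝ) - N| ≤ M := by
    intro N
    have : ((W N).length : ℝ) - N = ∑ π, (DirMultigraph.multiplicity (W N) π - N * v π) := by
      rw [Finset.sum_sub_distrib, DirMultigraph.sum_multiplicity, ← Finset.mul_sum, hsum, mul_one]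
    rw [this]
    refine (Finset.abs_sum_le_sum_abs _ _).trans ((Finset.sum_le_sum fun π _ => hWK N π).trans ?_)
    simp [M]
  have hlim : Tendsto (fun N => (W N).length + j) atTop atTop := by
    rw [← tendsto_natCast_atTop_iff (R := ℝ)]
    refine tendsto_atTop_mono (fun N => ?_)
      (tendsto_natCast_atTop_atTop.atTop_add (tendsto_const_nhds (x := -M)))
    have h := (abs_le.1 (hlen N)).1
    push_cast
    have : (0 : ℝ) ≤ j := j.cast_nonneg
    linarith
  -- `Av` excludes size 0, which an empty walk would give when `j = 0`; the sequence is shifted past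
  -- this.
  obtain ⟨N₀, hN₀⟩ := eventually_atTop.1 (hlim.eventually_ge_atTop 1)
  refine ⟨fun N => ⟨_, τ (N + N₀)⟩, fun N => ⟨hN₀ _ (by omega), hτ _⟩,
    hlim.comp (tendsto_add_atTop_nat N₀), fun π => ?_⟩
  refine Tendsto.comp (g := fun N => consecutiveProp π.1 (τ N)) ?_ (tendsto_add_atTop_nat N₀)
  rw [tendsto_iff_norm_sub_tendsto_zero]
  have hlim' : Tendsto (fun N => (((W N).length + j : ℕ) : ℝ)) atTop atTop :=
    tendsto_natCast_atTop_atTop.comp hlim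
  -- `K` bounds the gap between the count and `N * v π`; `(M + j) * |v π|` pays for replacing `N` by
  -- the actual size.
  refine squeeze_zero' (Eventually.of_forall fun _ => norm_nonneg _) ?_
    (hlim'.const_div_atTop (K + (M + j) * |v π|))
  filter_upwards [hlim.eventually_ge_atTop 1] with N hN
  have hpos : (0 : ℝ) < ((W N).length + j : ℕ) := by exact_mod_cast hN
  rw [consecutiveProp, (hτW N).consecutiveOcc_eq, Real.norm_eq_abs, le_div_iff₀ hpos]
  nth_rewrite 2 [← abs_of_pos hpos]
  rw [← abs_mul, sub_mul, div_mul_cancel₀ _ hpos.ne']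
  have h₁ := hWK N π
  have h₂ := hlen N
  calc _ = |(DirMultigraph.multiplicity (W N) π - N * v π) +
        (-(((W N).length : ℝ) - N) - j) * v π| := by
        congr 1
        push_cast
        ring
    _ ≤ _ := by
        refine (abs_add_le _ _).trans (add_le_add h₁ ?_)
        rw [abs_mul]
        refine mul_le_mul_of_nonneg_right ?_ (abs_nonneg _)
        refine (abs_sub _ _).trans ?_
        rw [abs_neg, Nat.abs_cast]
        linarith

theorem feasibleRegion_312_eq (j : ℕ) :
    feasibleRegion B312 (j + 1) =
      extendZero B312 (j + 1) '' cyclePolytope (overlapGraph B312 (j + 1)) := by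
  have := Fintype.ofFinite (AvSize B312 (j + 1))
  apply Set.Subset.antisymm
  · rintro v ⟨hv, σ, hσ, hsize, hlim⟩
    refine ⟨fun π => v π.1, ?_, funext fun π => ?_⟩
    · rw [DirMultigraph.cyclePolytope_eq]
      exact mem_unitCirculations_of_tendsto (fun π => (hv π.1).1) hσ hsize fun π => hlim π.1
    · by_cases hπ : Avoids B312 π
      · exact extendZero_apply (fun π : AvSize B312 (j + 1) => v π.1) ⟨π, hπ⟩
      · rw [extendZero_of_not_avoids _ hπ]
        refine tendsto_nhds_unique ?_ (hlim π)
        simp only [consecutiveProp_of_not_avoids (hσ _).2 hπ, tendsto_const_nhds]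
  · rintro _ ⟨v, hv, rfl⟩
    obtain ⟨σ, hσ, hsize, hlim⟩ := exists_tendsto_of_mem_cyclePolytope hv
    rw [DirMultigraph.cyclePolytope_eq] at hv
    refine ⟨fun π => ?_, σ, hσ, hsize, fun π => ?_⟩
    · by_cases hπ : Avoids B312 π
      · rw [extendZero_apply v ⟨π, hπ⟩, ← hv.2.2]
        exact ⟨hv.1 _, Finset.single_le_sum (fun e _ => hv.1 e) (Finset.mem_univ _)⟩
      · simp [extendZero_of_not_avoids v hπ]
    · by_cases hπ : Avoids B312 π
      · rw [extendZero_apply v ⟨π, hπ⟩]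
        exact hlim ⟨π, hπ⟩
      · simp only [consecutiveProp_of_not_avoids (hσ _).2 hπ, extendZero_of_not_avoids v hπ,
          tendsto_const_nhds]

theorem extremePoints_image_of_injective {E F : Type*} [AddCommGroup E] [Module ℝ E]
    [AddCommGroup F] [Module ℝ F] (f : E →ₗ[ℝ] F) (hf : Function.Injective f) (s : Set E) :
    Set.extremePoints ℝ (f '' s) = f '' Set.extremePoints ℝ s := by
  have hseg : ∀ x y z, f z ∈ openSegment ℝ (f x) (f y) ↔ z ∈ openSegment ℝ x y := by
    intro x y z
    have := image_openSegment ℝ f.toAffineMap x y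
    simp only [LinearMap.coe_toAffineMap] at this
    rw [← this, hf.mem_set_image]
  ext v
  constructor
  · rintro ⟨⟨x, hx, rfl⟩, h⟩
    exact ⟨x, ⟨hx, fun y hy z hz hxyz =>
      hf (h ⟨y, hy, rfl⟩ ⟨z, hz, rfl⟩ ((hseg _ _ _).2 hxyz))⟩, rfl⟩
  · rintro ⟨x, ⟨hx, h⟩, rfl⟩
    refine ⟨⟨x, hx, rfl⟩, ?_⟩
    rintro _ ⟨y, hy, rfl⟩ _ ⟨z, hz, rfl⟩ hxyz
    exact congrArg f (h hy hz ((hseg _ _ _).1 hxyz))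

end ConsecutivePatterns

theorem theorem1p6 (k : ℕ) (hk : 1 ≤ k) :
    ConsecutivePatterns.feasibleRegion ConsecutivePatterns.B312 k =
        ConsecutivePatterns.extendZero ConsecutivePatterns.B312 k ''
          ConsecutivePatterns.cyclePolytope
            (ConsecutivePatterns.overlapGraph ConsecutivePatterns.B312 k) ∧
      (Module.finrank ℝ (vectorSpan ℝ
          (ConsecutivePatterns.feasibleRegion ConsecutivePatterns.B312 k)) : ℤ) =
        (catalan k : ℤ) - (catalan (k - 1) : ℤ) ∧
      Set.extremePoints ℝ (ConsecutivePatterns.feasibleRegion ConsecutivePatterns.B312 k) =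
        {v | ∃ w : List (ConsecutivePatterns.AvSize ConsecutivePatterns.B312 k),
          (ConsecutivePatterns.overlapGraph ConsecutivePatterns.B312 k).IsSimpleCycle w ∧
            v = ConsecutivePatterns.extendZero ConsecutivePatterns.B312 k
              (ConsecutivePatterns.cycleVector w)} := by
  open ConsecutivePatterns in
  obtain ⟨j, rfl⟩ : ∃ j, k = j + 1 := ⟨k - 1, by omega⟩
  have := Fintype.ofFinite (AvSize B312 (j + 1))
  have := Fintype.ofFinite (AvSize B312 j)
  have hregion := feasibleRegion_312_eq j
  have himage : feasibleRegion B312 (j + 1) =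
      extendZeroLinear B312 (j + 1) '' cyclePolytope (overlapGraph B312 (j + 1)) := hregion
  refine ⟨hregion, ?_, ?_⟩
  · have hE : Fintype.card (AvSize B312 (j + 1)) = catalan (j + 1) := by
      rw [← Nat.card_eq_fintype_card, card_avoids_312]
    have hV : Fintype.card (AvSize B312 j) = catalan j := by
      rw [← Nat.card_eq_fintype_card, card_avoids_312]
    have : Nonempty (AvSize B312 (j + 1)) :=
      ⟨⟨1, avoids_312_iff.2 fun a b c hab hbc _ h => (h.trans (hab.trans hbc)).false⟩⟩
    have hdim := DirMultigraph.finrank_vectorSpan_unitCirculations (V := AvSize B312 j)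
      (G := overlapGraph B312 (j + 1)) exists_isWalkBetween_overlapGraph
    have hspan : vectorSpan ℝ (feasibleRegion B312 (j + 1)) =
        (vectorSpan ℝ (cyclePolytope (overlapGraph B312 (j + 1)))).map
          (extendZeroLinear B312 (j + 1)) := by
      rw [himage]
      exact (AffineMap.map_vectorSpan
        (extendZeroLinear B312 (j + 1)).toAffineMap).symm
    rw [hspan, ← (Submodule.equivMapOfInjective _ (extendZeroLinear_injective _ _) _).finrank_eq,
      DirMultigraph.cyclePolytope_eq,
      ← hE, ← hdim, hV]
    push_cast
    exact (add_sub_cancel_right _ _).symm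
  · rw [himage, extremePoints_image_of_injective _ (extendZeroLinear_injective _ _),
      DirMultigraph.extremePoints_cyclePolytope]
    ext v
    constructor
    · rintro ⟨_, ⟨w, hw, rfl⟩, rfl⟩
      exact ⟨w, hw, rfl⟩
    · rintro ⟨w, hw, rfl⟩
      exact ⟨_, ⟨w, hw, rfl⟩, rfl⟩
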